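/- Let $\alpha_1,\alpha_2>0$, $\beta_1,\beta_2>1$ and $F_i(k)=\alpha_i k^{\beta_i}$ for $k\in\mathbb N=\{1,2,\dots\}$, $i=1,2$. Let $(X(n))_{n\ge0}=(X_1(n),X_2(n))_{n\ge 0}$ be the generalized Pólya urn with feedback functions $F_1,F_2$, i.e. the Markov chain on $\mathbb N^2$ with deterministic initial configuration $X(0)\in\mathbb N^2$ and $$\mathbb P\big(X(n+1)-X(n)=e^{(i)}\,\big|\,X(n)\big)=\frac{F_i(X_i(n))}{F_1(X_1(n))+F_2(X_2(n))},\qquad i=1,2,$$ where $e^{(1)},e^{(2)}$ are the unit vectors. Let $X_2(\infty)=\lim_{n\to\infty}X_2(n)\in\mathbb N\cup\{\infty\}$, let $sMon_1=\{\exists N\ \forall n\ge N:\ X_2(n)=X_2(N)\}$ be the event of strong monopoly of agent 1, and let $$N_{mon}=\min\{n\ge1:\ \exists i\in\{1,2\}\ \forall m\ge n:\ X(m)-X(m-1)=e^{(i)}\}\qquad(\min\emptyset=\infty)$$ be the time of monopoly. Define $$k_1(n)=\begin{cases}n^{(\beta_1-1)/\beta_2}&\beta_1<\beta_2+1\\ n/2&\beta_1=\beta_2+1\\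 n-n^{\beta_2/(\beta_1-1)}&\beta_1>\beta_2+1\end{cases}\qquad k_2(n)=\begin{cases}c\,n^{(\beta_1-1)/(\beta_2-1)}&\beta_1<\beta_2\\ c\,n/2&\beta_2\le\beta_1<\beta_2+1\\ n-c\,n^{\beta_2/\beta_1}&\beta_1\ge\beta_2+1\end{cases}$$ where $c>0$ is a constant for which $$\liminf_{n\to\infty}\ \frac{\sum_{l\ge X_2(0)+k_2(n)}1/F_2(l)}{\sum_{l\ge X_1(0)+n-k_2(n)}1/F_1(l)}>1$$ (sums over integers $l\ge1$ in the given range). Assume the uniformity condition $$\sup_{\substack{n,k\in\mathbb{Z},\ n\ge1,\ k\ge0\\ k_1(n)\le k\le k_2(n)}}\ \frac{\mathbb P(X_2(n)=X_2(0)+k,\ sMon_1)}{\mathbb P(X_2(\infty)=X_2(0)+k)}<\infty .$$ Let $\beta=(\beta_1-1)/\beta_2$, and for sequences write $x_n\asymp y_n$ if $\limsup_n x_n/y_n<\infty$ and $\limsup_n y_n/x_n<\infty$. Then: 1. If $\beta_1\le\beta_2+1$, then $\mathbb P(N_{mon}=n\mid sMon_1)\asymp n^{\beta-\beta_1}$ as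 $n\to\infty$. 2. If $\beta_1\ge\beta_2+1$, then $\mathbb P(N_{mon}=n\mid sMon_1)\asymp n^{-\beta_2}$ as $n\to\infty$. -/

import Mathlib

open MeasureTheory ProbabilityTheory Filter Topology Asymptotics
open scoped ENNReal

namespace PolyaUrn

/-- `X` is a generalized Pólya urn process with `A` agents, feedback functions `F i` and initial
configuration `x₀`: a discrete-time Markov process started in `x₀` such that, given the past up to
time `n`, the next unit goes to agent `i` with probability
`F i (X n i) / ∑ j, F j (X n j)`. -/
structure IsUrn {Ω : Type*} [MeasurableSpace Ω] {A : ℕ} (μ : Measure Ω) (F : Fin A → ℕ → ℝ)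
    (x₀ : Fin A → ℕ) (X : ℕ → Ω → Fin A → ℕ) : Prop where
  measurable : ∀ n, Measurable (X n)
  init : ∀ᵐ ω ∂μ, X 0 ω = x₀
  step : ∀ (n : ℕ) (h : ℕ → Fin A → ℕ) (i : Fin A),
    μ ({ω | ∀ m ≤ n, X m ω = h m} ∩ {ω | X (n + 1) ω = X n ω + Pi.single i 1})
      = μ {ω | ∀ m ≤ n, X m ω = h m} * ENNReal.ofReal (F i (h n i) / ∑ j, F j (h n j))

/-- Strong monopoly of agent `i`: from some time on, no other agent wins any step. -/
def sMon {Ω : Type*} {A : ℕ} (X : ℕ → Ω → Fin A → ℕ) (i : Fin A) : Set Ω :=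
  {ω | ∃ N : ℕ, ∀ n ≥ N, ∀ j ≠ i, X n ω j = X N ω j}

/-- The limit `X_i(∞)` of the nondecreasing sequence `X_i(n)`, with values in `ℕ ∪ {∞}`. -/
noncomputable def wealthLim {Ω : Type*} {A : ℕ} (X : ℕ → Ω → Fin A → ℕ) (i : Fin A) (ω : Ω) : ℕ∞ :=
  ⨆ n : ℕ, (X n ω i : ℕ∞)

/-- The time of monopoly: the least `n ≥ 1` such that one and the same agent wins every step
`m ≥ n` (and `∞` if there is none). -/
noncomputable def monopolyTime {Ω : Type*} {A : ℕ} (X : ℕ → Ω → Fin A → ℕ) (ω : Ω) : ℕ∞ :=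
  ⨅ (n : ℕ) (_ : 1 ≤ n ∧ ∃ i : Fin A, ∀ m ≥ n, X m ω = X (m - 1) ω + Pi.single i 1), (n : ℕ∞)

/-- Power-law feedback `k ↦ α k ^ b`. -/
noncomputable def powerFeedback (α b : ℝ) (k : ℕ) : ℝ := α * (k : ℝ) ^ b

/-- The lower end `k₁(n)` of the range of moderate `k`, for feedback exponents `b₁`, `b₂`. -/
noncomputable def kLow (b₁ b₂ : ℝ) (n : ℕ) : ℝ :=
  if b₁ < b₂ + 1 then (n : ℝ) ^ ((b₁ - 1) / b₂)
  else if b₁ = b₂ + 1 then (n : ℝ) / 2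
  else (n : ℝ) - (n : ℝ) ^ (b₂ / (b₁ - 1))

/-- The upper end `k₂(n)` of the range of moderate `k`, with constant `c`. -/
noncomputable def kHigh (b₁ b₂ c : ℝ) (n : ℕ) : ℝ :=
  if b₁ < b₂ then c * (n : ℝ) ^ ((b₁ - 1) / (b₂ - 1))
  else if b₁ < b₂ + 1 then c * ((n : ℝ) / 2)
  else (n : ℝ) - c * (n : ℝ) ^ (b₂ / b₁)

/-- `∑ 1 / F l` over the positive integers `l ≥ s`. -/
noncomputable def tailSum (F : ℕ → ℝ) (s : ℝ) : ℝ≥0∞ :=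
  ∑' l : {l : ℕ // 1 ≤ l ∧ s ≤ (l : ℝ)}, ENNReal.ofReal (1 / F l)

/-- The requirement on the constant `c` in `k₂(n)`: asymptotically, the expected remaining
explosion time of agent 2 with `k₂(n)` steps won exceeds that of agent 1 with `n - k₂(n)` steps
won by a factor bounded away from one. -/
def AdmissibleConst (α b : Fin 2 → ℝ) (x₀ : Fin 2 → ℕ) (c : ℝ) : Prop :=
  0 < c ∧
  1 < liminf (fun n : ℕ =>
      tailSum (powerFeedback (α 1) (b 1)) ((x₀ 1 : ℝ) + kHigh (b 0) (b 1) c n) /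
      tailSum (powerFeedback (α 0) (b 0)) ((x₀ 0 : ℝ) + (n : ℝ) - kHigh (b 0) (b 1) c n)) atTop

/-- The uniformity condition on the convergence `X₂(n) → X₂(∞)` (agents 1 and 2 are the indices
`0` and `1`): the supremum, over `n ≥ 1` and integers `k₁(n) ≤ k ≤ k₂(n)`, of
`P(X₂(n) = X₂(0) + k, sMon₁) / P(X₂(∞) = X₂(0) + k)` is finite. -/
def UniformityCondition {Ω : Type*} [MeasurableSpace Ω] (μ : Measure Ω) (b : Fin 2 → ℝ)
    (x₀ : Fin 2 → ℕ) (X : ℕ → Ω → Fin 2 → ℕ) (c : ℝ) : Prop :=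
  (⨆ (n : ℕ) (k : ℕ)
      (_ : 1 ≤ n ∧ kLow (b 0) (b 1) n ≤ (k : ℝ) ∧ (k : ℝ) ≤ kHigh (b 0) (b 1) c n),
    μ ({ω | X n ω 1 = x₀ 1 + k} ∩ sMon X 0) /
      μ {ω | wealthLim X 1 ω = ((x₀ 1 + k : ℕ) : ℕ∞)}) < ∞

end PolyaUrn

/-! Write f_j and g_k for the rates of the first and second agent after j and k wins, and p(j,k) for
the probability that the urn visits that state. The normalised quantity w = p f g / (f + g) turns
the forward equation into an averaging: w(j+1,k+1) is the convex combination of w(j,k+1) and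
w(j+1,k) with weights proportional to f_{j+1} and g_{k+1}. Hence w stays between its boundary
values, and on the boundary it is a product of factors f/(f+g_0) or g/(f_0+g), bounded below because
1/f and 1/g are summable. So w is bounded above and away from zero on the whole quadrant
(`exists_bounds_of_average`).

On strong monopoly of the first agent, the monopoly time is N+2 exactly when, for some j+k=N, the
urn is in state (j,k) at time N, the second agent wins once more, and the first agent wins forever
after. This has probability (w/f_j) ∏_m f_{j+m}/(f_{j+m}+g_{k+1}). Here w/f_j is of order j^(-b₀).
The product is at least exp(-C k^b₁ j^(1-b₀)) and, for every p, at most a constant times (j^(b₀-1)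
k^(-b₁))^p; thus it acts as a cutoff to k^b₁ ≲ j^(b₀-1).

It remains to sum j^(-b₀) over the part of the antidiagonal j+k=N below the cutoff. If b₀ ≤ b₁+1,
about n^((b₀-1)/b₁) values of k with j of order n dominate, each of weight n^(-b₀). If b₀ ≥ b₁+1,
the sum runs over j ≳ n^(b₁/(b₀-1)), and its tail is of order n^(-b₁). -/

namespace PolyaUrn

/-! ### Maximum principle and elementary estimates for sums and products -/

/-- A positive solution of the discrete averaging equation on the quadrant, killed outside of it,
is bounded and bounded away from zero if the reciprocals of the weights are summable. -/
theorem exists_bounds_of_average {f g : ℕ → ℝ} {w : ℕ → ℕ → ℝ} (hf : ∀ j, 0 < f j)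
    (hg : ∀ k, 0 < g k) (hfs : Summable fun j => 1 / f j) (hgs : Summable fun k => 1 / g k)
    (h00 : 0 < w 0 0)
    (hj : ∀ j, w (j + 1) 0 = w j 0 * (f (j + 1) / (f (j + 1) + g 0)))
    (hk : ∀ k, w 0 (k + 1) = w 0 k * (g (k + 1) / (f 0 + g (k + 1))))
    (hjk : ∀ j k, w (j + 1) (k + 1) =
      (f (j + 1) * w j (k + 1) + g (k + 1) * w (j + 1) k) / (f (j + 1) + g (k + 1))) :
    ∃ m M : ℝ, 0 < m ∧ ∀ j k, m ≤ w j k ∧ w j k ≤ M := by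
  have ratio : ∀ x y : ℝ, 0 < x → 0 < y →
      Real.exp (-(y * (1 / x))) ≤ x / (x + y) ∧ x / (x + y) ≤ 1 := by
    intro x y hx hy
    refine ⟨?_, by rw [div_le_one (by positivity)]; linarith⟩
    rw [Real.exp_neg, ← one_div, div_le_div_iff₀ (Real.exp_pos _) (by positivity)]
    have := Real.add_one_le_exp (y * (1 / x))
    calc 1 * (x + y) = x * (y * (1 / x) + 1) := by field_simp; ring
      _ ≤ x * Real.exp (y * (1 / x)) := by gcongr
  -- Along an edge the recursion is a product of factors in [exp(-y/f), 1]; summability of 1/f keeps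
  -- it away from zero.
  have edge : ∀ (r : ℕ → ℝ) (f : ℕ → ℝ) (y : ℝ), 0 < y → (∀ j, 0 < f j) →
      (Summable fun j => 1 / f j) → 0 < r 0 →
      (∀ j, r (j + 1) = r j * (f (j + 1) / (f (j + 1) + y))) →
      ∃ m : ℝ, 0 < m ∧ ∀ j, m ≤ r j ∧ r j ≤ r 0 := by
    intro r f y hy hf hs h0 hr
    have key : ∀ j, r 0 * Real.exp (-(y * ∑ i ∈ Finset.range j, 1 / f (i + 1))) ≤ r j ∧
        r j ≤ r 0 := by
      intro j
      induction j with
      | zero => simp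
      | succ j ih =>
        obtain ⟨h1, h2⟩ := ratio (f (j + 1)) y (hf _) hy
        have hp : 0 < r j := lt_of_lt_of_le (by positivity) ih.1
        rw [hr, Finset.sum_range_succ, mul_add, neg_add, Real.exp_add, ← mul_assoc]
        refine ⟨by gcongr; exact ih.1, ?_⟩
        calc r j * _ ≤ r j * 1 := by gcongr
          _ ≤ r 0 := by linarith [ih.2]
    have hs' : Summable fun i => 1 / f (i + 1) := (summable_nat_add_iff 1).2 hs
    refine ⟨r 0 * Real.exp (-(y * ∑' i, 1 / f (i + 1))), by positivity, fun j => ⟨?_, (key j).2⟩⟩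
    refine le_trans ?_ (key j).1
    have := hs'.sum_le_tsum (Finset.range j) (fun i _ => by have := hf (i + 1); positivity)
    gcongr
  obtain ⟨m₁, hm₁, h₁⟩ := edge (fun j => w j 0) f (g 0) (hg 0) hf hfs h00 hj
  obtain ⟨m₂, hm₂, h₂⟩ := edge (fun k => w 0 k) g (f 0) (hf 0) hg hgs h00
    (fun k => by rw [hk, add_comm (f 0)])
  -- Edge values decrease from the corner, so `w 0 0` bounds both edges; averaging carries the
  -- bounds inwards.
  refine ⟨min m₁ m₂, w 0 0, lt_min hm₁ hm₂, ?_⟩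
  intro j
  induction j with
  | zero => exact fun k => ⟨(min_le_right _ _).trans (h₂ k).1, (h₂ k).2⟩
  | succ j ihj =>
    intro k
    induction k with
    | zero => exact ⟨(min_le_left _ _).trans (h₁ _).1, (h₁ _).2⟩
    | succ k ihk =>
      have hf' := hf (j + 1)
      have hg' := hg (k + 1)
      obtain ⟨a1, a2⟩ := ihj (k + 1)
      obtain ⟨b1, b2⟩ := ihk
      rw [hjk, le_div_iff₀ (by positivity), div_le_iff₀ (by positivity)]
      constructor
      · calc min m₁ m₂ * (f (j + 1) + g (k + 1))
            = f (j + 1) * min m₁ m₂ + g (k + 1) * min m₁ m₂ := by ring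
          _ ≤ _ := by gcongr
      · calc _ ≤ f (j + 1) * w 0 0 + g (k + 1) * w 0 0 := by gcongr
          _ = _ := by ring

/-- Tails of convergent power sums. -/
theorem sum_rpow_neg_le {s : ℝ} (hs : 1 < s) {a : ℕ} (ha : 1 ≤ a) (M : ℕ) :
    ∑ m ∈ Finset.range M, ((a + m : ℕ) : ℝ) ^ (-s) ≤
      2 ^ s / (s - 1) * (a : ℝ) ^ (1 - s) := by
  -- A telescoping comparison with the differences of m^(1-s); the factor 2^s pays for replacing m
  -- by m+1 ≤ 2m.
  have step : ∀ m : ℕ, 1 ≤ m → (m : ℝ) ^ (-s) ≤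
      2 ^ s / (s - 1) * ((m : ℝ) ^ (1 - s) - ((m + 1 : ℕ) : ℝ) ^ (1 - s)) := by
    intro m hm
    have hm0 : (0 : ℝ) < m := by exact_mod_cast hm
    have hm1 : (1 : ℝ) ≤ m := by exact_mod_cast hm
    have hM : (0 : ℝ) < m + 1 := by positivity
    have h1 : ((m : ℝ) + 1) ^ (1 - s) * (1 + (s - 1) / (m + 1)) ≤ (m : ℝ) ^ (1 - s) := by
      have : (m : ℝ) = (m + 1) * (1 - 1 / (m + 1)) := by field_simp; ring
      have hx : (0 : ℝ) < 1 - 1 / (m + 1) := by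
        rw [sub_pos, div_lt_one hM]; linarith
      conv_rhs => rw [this, Real.mul_rpow hM.le hx.le]
      gcongr
      rw [Real.rpow_def_of_pos hx]
      have hl := Real.log_le_sub_one_of_pos hx
      have he := Real.add_one_le_exp (Real.log (1 - 1 / ((m : ℝ) + 1)) * (1 - s))
      have : (s - 1) / ((m : ℝ) + 1) ≤ Real.log (1 - 1 / ((m : ℝ) + 1)) * (1 - s) := by
        have h3 : (1 / ((m : ℝ) + 1)) * (s - 1) ≤
            -Real.log (1 - 1 / ((m : ℝ) + 1)) * (s - 1) := by
          apply mul_le_mul_of_nonneg_right _ (by linarith)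
          linarith
        calc _ = (1 / ((m : ℝ) + 1)) * (s - 1) := by ring
          _ ≤ _ := h3
          _ = _ := by ring
      linarith
    have h2 : (m : ℝ) ^ (-s) ≤ 2 ^ s * ((m : ℝ) + 1) ^ (-s) := by
      rw [Real.rpow_neg hm0.le, Real.rpow_neg hM.le, ← div_eq_mul_inv, inv_eq_one_div,
        div_le_div_iff₀ (by positivity) (by positivity), one_mul,
        ← Real.mul_rpow (by norm_num) hm0.le]
      apply Real.rpow_le_rpow hM.le (by linarith) (by linarith)
    have h3 : ((m : ℝ) + 1) ^ (1 - s) * (1 + (s - 1) / (m + 1)) =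
        ((m : ℝ) + 1) ^ (1 - s) + (s - 1) * ((m : ℝ) + 1) ^ (-s) := by
      rw [show (1 - s) = 1 + -s by ring, Real.rpow_add hM, Real.rpow_one]
      field_simp
    have hs0 : 0 < s - 1 := by linarith
    push_cast
    calc (m : ℝ) ^ (-s) ≤ 2 ^ s * ((m : ℝ) + 1) ^ (-s) := h2
      _ = 2 ^ s / (s - 1) * ((s - 1) * ((m : ℝ) + 1) ^ (-s)) := by field_simp
      _ ≤ _ := by gcongr; linarith
  have hs0 : 0 < s - 1 := by linarith
  have key : ∑ m ∈ Finset.range M, ((a + m : ℕ) : ℝ) ^ (-s) ≤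
      2 ^ s / (s - 1) * ((a : ℝ) ^ (1 - s) - ((a + M : ℕ) : ℝ) ^ (1 - s)) := by
    induction M with
    | zero => simp
    | succ M ih =>
      rw [Finset.sum_range_succ]
      have := step (a + M) (by omega)
      rw [show a + (M + 1) = a + M + 1 by ring]
      linarith
  refine key.trans ?_
  gcongr
  have : (0 : ℝ) ≤ ((a + M : ℕ) : ℝ) ^ (1 - s) := by positivity
  linarith

/-- Factorwise this is 1 + t ≤ exp t with t = y / f m. -/
theorem exp_le_prod_div {f : ℕ → ℝ} {y : ℝ} (hf : ∀ m, 0 < f m) (hy : 0 ≤ y) (M : ℕ) :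
    Real.exp (-(y * ∑ m ∈ Finset.range M, 1 / f m)) ≤
      ∏ m ∈ Finset.range M, f m / (f m + y) := by
  rw [Finset.mul_sum, ← Finset.sum_neg_distrib, Real.exp_sum]
  refine Finset.prod_le_prod (fun _ _ => (Real.exp_pos _).le) fun m _ => ?_
  have := hf m
  rw [Real.exp_neg, ← one_div, div_le_div_iff₀ (Real.exp_pos _) (by positivity)]
  have := Real.add_one_le_exp (y * (1 / f m))
  calc 1 * (f m + y) = f m * (y * (1 / f m) + 1) := by field_simp; ring
    _ ≤ f m * Real.exp (y * (1 / f m)) := by gcongr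

/-- Each block of a factors contributes at most (1 + y/K)^(-a) ≤ K/(a y) by Bernoulli; p blocks give
a polynomial decay of any desired order. -/
theorem prod_div_le {f : ℕ → ℝ} {y K : ℝ} {a p : ℕ} (hf : ∀ m, 0 < f m) (hy : 0 < y)
    (ha : 1 ≤ a) (hK : ∀ m < a * p, f m ≤ K) :
    ∏ m ∈ Finset.range (a * p), f m / (f m + y) ≤ (K / (a * y)) ^ p := by
  rcases Nat.eq_zero_or_pos p with rfl | hp
  · simp
  have hKp : 0 < K := (hf 0).trans_le (hK 0 (by positivity))
  have ha' : (0 : ℝ) < a := by exact_mod_cast ha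
  calc ∏ m ∈ Finset.range (a * p), f m / (f m + y)
      ≤ ∏ m ∈ Finset.range (a * p), K / (K + y) := by
        refine Finset.prod_le_prod (fun m _ => by have := hf m; positivity) fun m hm => ?_
        have h1 := hf m
        have h2 := hK m (Finset.mem_range.1 hm)
        rw [div_le_div_iff₀ (by positivity) (by positivity)]
        nlinarith
    _ = ((K / (K + y)) ^ a) ^ p := by rw [Finset.prod_const, Finset.card_range, pow_mul]
    _ ≤ (K / (a * y)) ^ p := by
        gcongr
        have h := one_add_mul_le_pow (a := y / K) (by have : 0 < y / K := by positivity
                                                      linarith) a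
        have h' : (K / (K + y)) = (1 + y / K)⁻¹ := by field_simp
        rw [h', inv_pow, ← one_div, div_le_div_iff₀ (by positivity) (by positivity)]
        calc 1 * (a * y) = K * (a * (y / K)) := by field_simp
          _ ≤ K * (1 + y / K) ^ a := by gcongr; linarith

/-! ### The Markov property for events of the past -/

section Paths

variable {Ω : Type*} [MeasurableSpace Ω] {μ : Measure Ω}

theorem IsUrn.measurableSet_eq {A : ℕ} {F : Fin A → ℕ → ℝ} {x₀ : Fin A → ℕ}
    {X : ℕ → Ω → Fin A → ℕ} (hX : IsUrn μ F x₀ X) (n : ℕ) (s : Fin A → ℕ) :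
    MeasurableSet {ω | X n ω = s} :=
  hX.measurable n (measurableSet_singleton s)

theorem IsUrn.measurableSet_step {A : ℕ} {F : Fin A → ℕ → ℝ} {x₀ : Fin A → ℕ}
    {X : ℕ → Ω → Fin A → ℕ} (hX : IsUrn μ F x₀ X) (n : ℕ) (i : Fin A) :
    MeasurableSet {ω | X (n + 1) ω = X n ω + Pi.single i 1} :=
  measurableSet_eq_fun (hX.measurable _) ((hX.measurable n).add_const _)

/-- The transition probabilities conditionally on any event of the past. -/
theorem IsUrn.measure_inter_step {A : ℕ} {F : Fin A → ℕ → ℝ} {x₀ : Fin A → ℕ}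
    {X : ℕ → Ω → Fin A → ℕ} (hX : IsUrn μ F x₀ X) (n : ℕ) {E : Set Ω} {s : Fin A → ℕ}
    (hE : ∀ ω ω', (∀ m ≤ n, X m ω = X m ω') → ω ∈ E → ω' ∈ E) (hs : ∀ ω ∈ E, X n ω = s)
    (i : Fin A) :
    μ (E ∩ {ω | X (n + 1) ω = X n ω + Pi.single i 1}) =
      μ E * ENNReal.ofReal (F i (s i) / ∑ j, F j (s j)) := by
  -- Histories up to time n form a countable type, so E splits into countably many history events,
  -- all with the same transition probability because the last state is s.
  let Y : Ω → Fin (n + 1) → Fin A → ℕ := fun ω m => X m ω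
  have hY : Measurable Y := measurable_pi_lambda _ fun m => hX.measurable m
  have hYm : ∀ h, MeasurableSet {ω | Y ω = h} := fun h => hY (measurableSet_singleton h)
  have hEY : E = ⋃ h ∈ Y '' E, {ω | Y ω = h} := by
    ext ω
    simp only [Set.mem_iUnion, Set.mem_ofPred_eq, exists_prop, Set.mem_image]
    constructor
    · exact fun h => ⟨_, ⟨ω, h, rfl⟩, rfl⟩
    · rintro ⟨_, ⟨ω', h', rfl⟩, h⟩
      exact hE ω' ω (fun m hm => (congrFun h ⟨m, by omega⟩).symm) h'
  have hdisj : (Y '' E).PairwiseDisjoint fun h => {ω | Y ω = h} := by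
    intro h _ h' _ hne
    refine Set.disjoint_left.2 fun ω h1 h2 => hne ?_
    rw [← h1, ← h2]
  have hc : (Y '' E).Countable := Set.to_countable _
  conv_lhs => rw [hEY, Set.iUnion₂_inter]
  conv_rhs => rw [hEY]
  rw [measure_biUnion hc hdisj fun h _ => hYm h, measure_biUnion hc
    (fun h hh h' hh' hne => (hdisj hh hh' hne).mono Set.inter_subset_left Set.inter_subset_left)
    fun h _ => (hYm h).inter (hX.measurableSet_step n i), ← ENNReal.tsum_mul_right]
  congr 1
  ext ⟨h, hh⟩
  obtain ⟨ω, hω, rfl⟩ := hh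
  have key := hX.step n (fun m => X m ω) i
  have hset : {ω' | Y ω' = Y ω} = {ω' | ∀ m ≤ n, X m ω' = X m ω} := by
    ext ω'
    refine ⟨fun h m hm => congrFun h ⟨m, by omega⟩, fun h => funext fun m => h m (by omega)⟩
  rw [hs ω hω] at key
  simp only [hset]
  exact key

end Paths

/-! ### Paths and visit probabilities for two agents -/

section TwoAgents

variable {Ω : Type*} [MeasurableSpace Ω] {μ : Measure Ω} {F : Fin 2 → ℕ → ℝ} {x₀ : Fin 2 → ℕ}
  {X : ℕ → Ω → Fin 2 → ℕ}

/-- A path of the urn: it starts in `x₀` and one unit is added in each step. -/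
def IsPath (x₀ : Fin 2 → ℕ) (x : ℕ → Fin 2 → ℕ) : Prop :=
  x 0 = x₀ ∧ ∀ n, x (n + 1) = x n + Pi.single 0 1 ∨ x (n + 1) = x n + Pi.single 1 1

/-- The state after `j` wins of the first and `k` wins of the second agent. -/
def state (x₀ : Fin 2 → ℕ) (j k : ℕ) : Fin 2 → ℕ := ![x₀ 0 + j, x₀ 1 + k]

@[simp] theorem state_apply_zero (j k : ℕ) : state x₀ j k 0 = x₀ 0 + j := rfl

@[simp] theorem state_apply_one (j k : ℕ) : state x₀ j k 1 = x₀ 1 + k := rfl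

theorem state_add_single_zero (j k : ℕ) :
    state x₀ j k + Pi.single 0 1 = state x₀ (j + 1) k := by
  ext i; fin_cases i <;> simp [state, add_assoc]

theorem state_add_single_one (j k : ℕ) :
    state x₀ j k + Pi.single 1 1 = state x₀ j (k + 1) := by
  ext i; fin_cases i <;> simp [state, add_assoc]

theorem state_inj {j k j' k' : ℕ} : state x₀ j k = state x₀ j' k' ↔ j = j' ∧ k = k' := by
  constructor
  · intro h
    have h0 := congrFun h 0
    have h1 := congrFun h 1
    simp at h0 h1
    exact ⟨h0, h1⟩
  · rintro ⟨rfl, rfl⟩; rfl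

theorem IsPath.exists_state {x : ℕ → Fin 2 → ℕ} (hx : IsPath x₀ x) (n : ℕ) :
    ∃ j k, j + k = n ∧ x n = state x₀ j k := by
  induction n with
  | zero =>
    refine ⟨0, 0, rfl, ?_⟩
    rw [hx.1]
    ext i; fin_cases i <;> simp
  | succ n ih =>
    obtain ⟨j, k, h, hs⟩ := ih
    rcases hx.2 n with h' | h'
    · exact ⟨j + 1, k, by omega, by rw [h', hs, state_add_single_zero]⟩
    · exact ⟨j, k + 1, by omega, by rw [h', hs, state_add_single_one]⟩

theorem IsUrn.ae_isPath [IsProbabilityMeasure μ] (hF : ∀ i k, 1 ≤ k → 0 < F i k)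
    (hx₀ : ∀ i, 1 ≤ x₀ i) (hX : IsUrn μ F x₀ X) : ∀ᵐ ω ∂μ, IsPath x₀ fun n => X n ω := by
  have main : ∀ n : ℕ, ∀ᵐ ω ∂μ, (∃ j k, j + k = n ∧ X n ω = state x₀ j k) →
      X (n + 1) ω = X n ω + Pi.single 0 1 ∨ X (n + 1) ω = X n ω + Pi.single 1 1 := by
    intro n
    have : ∀ j k : ℕ, ∀ᵐ ω ∂μ, X n ω = state x₀ j k →
        X (n + 1) ω = X n ω + Pi.single 0 1 ∨ X (n + 1) ω = X n ω + Pi.single 1 1 := by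
      intro j k
      set E := {ω | X n ω = state x₀ j k}
      have h0 := hX.measure_inter_step n (E := E) (s := state x₀ j k)
        (fun ω ω' h hω => (h n le_rfl).symm.trans hω) (fun ω h => h) 0
      have h1 := hX.measure_inter_step n (E := E) (s := state x₀ j k)
        (fun ω ω' h hω => (h n le_rfl).symm.trans hω) (fun ω h => h) 1
      set A := {ω | X (n + 1) ω = X n ω + Pi.single 0 1}
      set B := {ω | X (n + 1) ω = X n ω + Pi.single 1 1}
      have hF0 := hF 0 (x₀ 0 + j) (by have := hx₀ 0; omega)
      have hF1 := hF 1 (x₀ 1 + k) (by have := hx₀ 1; omega)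
      have hdisj : Disjoint (E ∩ A) (E ∩ B) := by
        refine Set.disjoint_left.2 fun ω ha hb => ?_
        have := ha.2.symm.trans hb.2
        have := congrFun this 0
        simp at this
      have hm : MeasurableSet E := hX.measurableSet_eq n _
      have hA : MeasurableSet A := hX.measurableSet_step n 0
      have hB : MeasurableSet B := hX.measurableSet_step n 1
      -- The two disjoint transitions have total conditional probability one, so anything else is
      -- null.
      have hsum : μ (E ∩ A ∪ E ∩ B) = μ E := by
        rw [measure_union hdisj (hm.inter hB), h0, h1, ← mul_add,
          ← ENNReal.ofReal_add (by simp; positivity) (by simp; positivity)]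
        simp only [Fin.sum_univ_two, state_apply_zero, state_apply_one]
        rw [← add_div, div_self (by positivity)]
        simp
      have hz : μ (E \ (E ∩ A ∪ E ∩ B)) = 0 := by
        rw [measure_sdiff (Set.union_subset Set.inter_subset_left Set.inter_subset_left)
          ((hm.inter hA).union (hm.inter hB)).nullMeasurableSet (measure_ne_top _ _), hsum,
          tsub_self]
      rw [ae_iff]
      refine measure_mono_null ?_ hz
      intro ω hω
      simp only [Set.mem_ofPred_eq, Classical.not_imp, not_or] at hω
      refine ⟨hω.1, ?_⟩
      rintro (h | h)
      · exact hω.2.1 h.2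
      · exact hω.2.2 h.2
    filter_upwards [ae_all_iff.2 fun j => ae_all_iff.2 (this j)] with ω hω
    rintro ⟨j, k, -, h⟩
    exact hω j k h
  filter_upwards [hX.init, ae_all_iff.2 main] with ω h0 hω
  have hst : ∀ n, ∃ j k, j + k = n ∧ X n ω = state x₀ j k := by
    intro n
    induction n with
    | zero =>
      refine ⟨0, 0, rfl, ?_⟩
      rw [h0]
      ext i; fin_cases i <;> simp
    | succ n ih =>
      have h' := hω n ih
      obtain ⟨j, k, h, hs⟩ := ih
      rcases h' with h' | h'
      · exact ⟨j + 1, k, by omega, by rw [h', hs, state_add_single_zero]⟩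
      · exact ⟨j, k + 1, by omega, by rw [h', hs, state_add_single_one]⟩
  exact ⟨h0, fun n => hω n (hst n)⟩

/-- One step of the urn from a given state, for real-valued probabilities. -/
theorem IsUrn.measureReal_inter_step (hX : IsUrn μ F x₀ X)
    (hF : ∀ i k, 1 ≤ k → 0 < F i k) (hx₀ : ∀ i, 1 ≤ x₀ i) (n : ℕ) {E : Set Ω} {j k : ℕ}
    (hE : ∀ ω ω', (∀ m ≤ n, X m ω = X m ω') → ω ∈ E → ω' ∈ E)
    (hs : ∀ ω ∈ E, X n ω = state x₀ j k) :
    μ.real (E ∩ {ω | X (n + 1) ω = state x₀ (j + 1) k}) =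
      μ.real E * (F 0 (x₀ 0 + j) / (F 0 (x₀ 0 + j) + F 1 (x₀ 1 + k))) ∧
    μ.real (E ∩ {ω | X (n + 1) ω = state x₀ j (k + 1)}) =
      μ.real E * (F 1 (x₀ 1 + k) / (F 0 (x₀ 0 + j) + F 1 (x₀ 1 + k))) := by
  have hF0 := hF 0 (x₀ 0 + j) (by have := hx₀ 0; omega)
  have hF1 := hF 1 (x₀ 1 + k) (by have := hx₀ 1; omega)
  have e0 : E ∩ {ω | X (n + 1) ω = state x₀ (j + 1) k} =
      E ∩ {ω | X (n + 1) ω = X n ω + Pi.single 0 1} := by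
    ext ω
    refine and_congr_right fun hω => ?_
    simp only [Set.mem_ofPred_eq]
    rw [hs ω hω, state_add_single_zero]
  have e1 : E ∩ {ω | X (n + 1) ω = state x₀ j (k + 1)} =
      E ∩ {ω | X (n + 1) ω = X n ω + Pi.single 1 1} := by
    ext ω
    refine and_congr_right fun hω => ?_
    simp only [Set.mem_ofPred_eq]
    rw [hs ω hω, state_add_single_one]
  simp only [e0, e1, Measure.real]
  rw [hX.measure_inter_step n hE hs 0, hX.measure_inter_step n hE hs 1, ENNReal.toReal_mul,
    ENNReal.toReal_mul, ENNReal.toReal_ofReal (by simp; positivity),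
    ENNReal.toReal_ofReal (by simp; positivity)]
  simp

/-- The probability to visit the state with `j` and `k` wins. -/
noncomputable def visitProb (μ : Measure Ω) (x₀ : Fin 2 → ℕ) (X : ℕ → Ω → Fin 2 → ℕ)
    (j k : ℕ) : ℝ :=
  μ.real {ω | X (j + k) ω = state x₀ j k}

theorem IsUrn.visitProb_zero_zero [IsProbabilityMeasure μ] (hX : IsUrn μ F x₀ X) :
    visitProb μ x₀ X 0 0 = 1 := by
  have h : {ω | X 0 ω = state x₀ 0 0} =ᵐ[μ] Set.univ := by
    filter_upwards [hX.init] with ω h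
    refine propext ⟨fun _ => trivial, fun _ => ?_⟩
    change X 0 ω = _
    rw [h]
    ext i; fin_cases i <;> simp
  rw [visitProb, add_zero, measureReal_congr h, probReal_univ]

section Visit

variable [IsProbabilityMeasure μ] (hX : IsUrn μ F x₀ X) (hF : ∀ i k, 1 ≤ k → 0 < F i k)
  (hx₀ : ∀ i, 1 ≤ x₀ i)

include hX hF hx₀

theorem IsUrn.visitProb_succ_zero (j : ℕ) :
    visitProb μ x₀ X (j + 1) 0 =
      visitProb μ x₀ X j 0 * (F 0 (x₀ 0 + j) / (F 0 (x₀ 0 + j) + F 1 (x₀ 1))) := by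
  have h := (hX.measureReal_inter_step hF hx₀ j (E := {ω | X j ω = state x₀ j 0}) (j := j)
    (k := 0) (fun ω ω' h hω => (h j le_rfl).symm.trans hω) (fun ω h => h)).1
  simp only [visitProb, add_zero] at h ⊢
  rw [← h]
  refine measureReal_congr ?_
  filter_upwards [hX.ae_isPath hF hx₀] with ω hω
  refine propext ⟨fun h1 => ⟨?_, h1⟩, fun h1 => h1.2⟩
  have h1 : X (j + 1) ω = state x₀ (j + 1) 0 := h1
  obtain ⟨j', k', hs, hst⟩ := hω.exists_state j
  rcases hω.2 j with h2 | h2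
  · simp only [h1, hst, state_add_single_zero, state_inj] at h2
    change X j ω = _
    rw [hst, state_inj]; omega
  · simp only [h1, hst, state_add_single_one, state_inj] at h2
    omega

theorem IsUrn.visitProb_zero_succ (k : ℕ) :
    visitProb μ x₀ X 0 (k + 1) =
      visitProb μ x₀ X 0 k * (F 1 (x₀ 1 + k) / (F 0 (x₀ 0) + F 1 (x₀ 1 + k))) := by
  have h := (hX.measureReal_inter_step hF hx₀ k (E := {ω | X k ω = state x₀ 0 k}) (j := 0)
    (k := k) (fun ω ω' h hω => (h k le_rfl).symm.trans hω) (fun ω h => h)).2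
  simp only [visitProb, add_zero, zero_add] at h ⊢
  rw [← h]
  refine measureReal_congr ?_
  filter_upwards [hX.ae_isPath hF hx₀] with ω hω
  refine propext ⟨fun h1 => ⟨?_, h1⟩, fun h1 => h1.2⟩
  have h1 : X (k + 1) ω = state x₀ 0 (k + 1) := h1
  obtain ⟨j', k', hs, hst⟩ := hω.exists_state k
  rcases hω.2 k with h2 | h2
  · simp only [h1, hst, state_add_single_zero, state_inj] at h2
    omega
  · simp only [h1, hst, state_add_single_one, state_inj] at h2
    change X k ω = _
    rw [hst, state_inj]; omega

/-- A path enters an interior state by its last step from exactly one of the two predecessors. -/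
theorem IsUrn.visitProb_succ_succ (j k : ℕ) :
    visitProb μ x₀ X (j + 1) (k + 1) =
      visitProb μ x₀ X j (k + 1) *
        (F 0 (x₀ 0 + j) / (F 0 (x₀ 0 + j) + F 1 (x₀ 1 + (k + 1)))) +
      visitProb μ x₀ X (j + 1) k *
        (F 1 (x₀ 1 + k) / (F 0 (x₀ 0 + (j + 1)) + F 1 (x₀ 1 + k))) := by
  set n := j + k + 1 with hn
  have h0 := (hX.measureReal_inter_step hF hx₀ n (E := {ω | X n ω = state x₀ j (k + 1)}) (j := j)
    (k := k + 1) (fun ω ω' h hω => (h n le_rfl).symm.trans hω) (fun ω h => h)).1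
  have h1 := (hX.measureReal_inter_step hF hx₀ n (E := {ω | X n ω = state x₀ (j + 1) k})
    (j := j + 1) (k := k) (fun ω ω' h hω => (h n le_rfl).symm.trans hω) (fun ω h => h)).2
  simp only [visitProb]
  rw [show j + (k + 1) = n by omega, show j + 1 + k = n by omega,
    show j + 1 + (k + 1) = n + 1 by omega, ← h0, ← h1, ← measureReal_union]
  · refine measureReal_congr ?_
    filter_upwards [hX.ae_isPath hF hx₀] with ω hω
    refine propext ⟨fun h1 => ?_, fun h1 => h1.elim And.right And.right⟩
    have h1 : X (n + 1) ω = state x₀ (j + 1) (k + 1) := h1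
    obtain ⟨j', k', hs, hst⟩ := hω.exists_state n
    rcases hω.2 n with h2 | h2
    · simp only [h1, hst, state_add_single_zero, state_inj] at h2
      refine Or.inl ⟨?_, h1⟩
      change X n ω = _
      rw [hst, state_inj]; omega
    · simp only [h1, hst, state_add_single_one, state_inj] at h2
      refine Or.inr ⟨?_, h1⟩
      change X n ω = _
      rw [hst, state_inj]; omega
  · refine Set.disjoint_left.2 fun ω ha hb => ?_
    have := (ha.1 : X n ω = _).symm.trans hb.1
    rw [state_inj] at this
    omega
  · exact (hX.measurableSet_eq _ _).inter (hX.measurableSet_eq _ _)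

/-- After normalisation by the rates, visit probabilities are bounded above and below. -/
theorem IsUrn.exists_visitProb_bounds (h0 : Summable fun j => 1 / F 0 (x₀ 0 + j))
    (h1 : Summable fun k => 1 / F 1 (x₀ 1 + k)) :
    ∃ m M : ℝ, 0 < m ∧ ∀ j k,
      m ≤ visitProb μ x₀ X j k * (F 0 (x₀ 0 + j) * F 1 (x₀ 1 + k) /
        (F 0 (x₀ 0 + j) + F 1 (x₀ 1 + k))) ∧
      visitProb μ x₀ X j k * (F 0 (x₀ 0 + j) * F 1 (x₀ 1 + k) /
        (F 0 (x₀ 0 + j) + F 1 (x₀ 1 + k))) ≤ M := by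
  have hf : ∀ j, 0 < F 0 (x₀ 0 + j) := fun j => hF 0 _ (by have := hx₀ 0; omega)
  have hg : ∀ k, 0 < F 1 (x₀ 1 + k) := fun k => hF 1 _ (by have := hx₀ 1; omega)
  -- The factor f g / (f + g) is chosen so that p(j,k+1) f_j/(f_j+g_{k+1}) equals w(j,k+1)/g_{k+1},
  -- and symmetrically; the forward equation then becomes an average.
  refine exists_bounds_of_average (w := fun j k => visitProb μ x₀ X j k *
    (F 0 (x₀ 0 + j) * F 1 (x₀ 1 + k) / (F 0 (x₀ 0 + j) + F 1 (x₀ 1 + k)))) hf hg h0 h1 ?_ ?_ ?_ ?_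
  · have := hf 0
    have := hg 0
    rw [hX.visitProb_zero_zero]
    positivity
  · intro j
    have := hf j
    have := hf (j + 1)
    have := hg 0
    rw [add_zero] at this
    simp only [hX.visitProb_succ_zero hF hx₀, add_zero]
    field_simp
  · intro k
    have := hg k
    have := hg (k + 1)
    have := hf 0
    rw [add_zero] at this
    simp only [hX.visitProb_zero_succ hF hx₀, add_zero]
    field_simp
  · intro j k
    have := hf j
    have := hf (j + 1)
    have := hg k
    have := hg (k + 1)
    simp only [hX.visitProb_succ_succ hF hx₀]
    field_simp

end Visit

end TwoAgents

/-! ### Decomposition of the monopoly time by the last win of the second agent -/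

theorem monopolyTime_eq_iff {Ω : Type*} {A : ℕ} (X : ℕ → Ω → Fin A → ℕ) (ω : Ω) (n : ℕ) :
    monopolyTime X ω = n ↔
      (1 ≤ n ∧ ∃ i : Fin A, ∀ m ≥ n, X m ω = X (m - 1) ω + Pi.single i 1) ∧
      ∀ l < n, ¬ (1 ≤ l ∧ ∃ i : Fin A, ∀ m ≥ l, X m ω = X (m - 1) ω + Pi.single i 1) := by
  unfold monopolyTime
  generalize hP : (fun n : ℕ => 1 ≤ n ∧ ∃ i : Fin A, ∀ m ≥ n, X m ω = X (m - 1) ω + Pi.single i 1)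
    = P
  have hP' : ∀ n, (1 ≤ n ∧ ∃ i : Fin A, ∀ m ≥ n, X m ω = X (m - 1) ω + Pi.single i 1) = P n :=
    fun n => congrFun hP n
  simp only [hP']
  constructor
  · intro h
    by_cases hne : ∃ l, P l
    · classical
      have hmin : (⨅ (n : ℕ) (_ : P n), (n : ℕ∞)) = (Nat.find hne : ℕ) := by
        refine le_antisymm (iInf₂_le _ (Nat.find_spec hne)) (le_iInf₂ fun l hl => ?_)
        exact_mod_cast Nat.find_min' hne hl
      rw [hmin, Nat.cast_inj] at h
      rw [← h]
      exact ⟨Nat.find_spec hne, fun l hl => Nat.find_min hne hl⟩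
    · have : (⨅ (n : ℕ) (_ : P n), (n : ℕ∞)) = ⊤ := by
        simp only [iInf_eq_top]
        exact fun l hl => (hne ⟨l, hl⟩).elim
      rw [this] at h
      exact (ENat.top_ne_natCast n h).elim
  · rintro ⟨h1, h2⟩
    refine le_antisymm (iInf₂_le _ h1) (le_iInf₂ fun l hl => ?_)
    by_contra hlt
    exact h2 l (by exact_mod_cast not_le.1 hlt) hl

section TwoAgents

variable {Ω : Type*} {F : Fin 2 → ℕ → ℝ} {x₀ : Fin 2 → ℕ} {X : ℕ → Ω → Fin 2 → ℕ}

/-- From the state with `j` and `k` wins the second agent wins once and the first agent wins the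
following `M` steps. -/
def escape (x₀ : Fin 2 → ℕ) (X : ℕ → Ω → Fin 2 → ℕ) (j k M : ℕ) : Set Ω :=
  {ω | X (j + k) ω = state x₀ j k ∧ ∀ m ≤ M, X (j + k + 1 + m) ω = state x₀ (j + m) (k + 1)}

/-- From the state with `j` and `k` wins the second agent wins once and the first agent wins all
later steps. -/
def escapeForever (x₀ : Fin 2 → ℕ) (X : ℕ → Ω → Fin 2 → ℕ) (j k : ℕ) : Set Ω :=
  {ω | X (j + k) ω = state x₀ j k ∧ ∀ m, X (j + k + 1 + m) ω = state x₀ (j + m) (k + 1)}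

theorem escapeForever_eq_iInter (j k : ℕ) :
    escapeForever x₀ X j k = ⋂ M, escape x₀ X j k M := by
  ext ω
  simp only [Set.mem_iInter]
  exact ⟨fun h M => ⟨h.1, fun m _ => h.2 m⟩, fun h => ⟨(h 0).1, fun m => (h m).2 m le_rfl⟩⟩

theorem antitone_escape (j k : ℕ) : Antitone (escape x₀ X j k) :=
  fun _ _ hMN _ h => ⟨h.1, fun m hm => h.2 m (hm.trans hMN)⟩

theorem escapeForever_subset_sMon (j k : ℕ) : escapeForever x₀ X j k ⊆ sMon X 0 := by
  rintro ω ⟨-, h⟩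
  have key : ∀ n ≥ j + k + 1, X n ω 1 = x₀ 1 + (k + 1) := by
    intro n hn
    obtain ⟨m, rfl⟩ := Nat.exists_eq_add_of_le hn
    rw [h, state_apply_one]
  refine ⟨j + k + 1, fun n hn i hi => ?_⟩
  obtain rfl : i = 1 := by omega
  rw [key n hn, key _ le_rfl]

theorem monopolyTime_of_mem_escapeForever {j k : ℕ} {ω : Ω} (hω : ω ∈ escapeForever x₀ X j k) :
    monopolyTime X ω = ((j + k + 2 : ℕ) : ℕ∞) := by
  obtain ⟨h0, h⟩ := hω
  rw [monopolyTime_eq_iff]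
  refine ⟨⟨by omega, 0, fun m hm => ?_⟩, ?_⟩
  · obtain ⟨l, rfl⟩ := Nat.exists_eq_add_of_le hm
    have h1 := h (l + 1)
    have h2 := h l
    rw [show j + k + 2 + l - 1 = j + k + 1 + l by omega,
      show j + k + 2 + l = j + k + 1 + (l + 1) by omega, h1, h2, state_add_single_zero, add_assoc]
  -- A smaller l would make one agent win both steps j+k+1 and j+k+2, which go to different agents.
  · rintro l hl ⟨-, i, hi⟩
    have h1 := hi (j + k + 1) (by omega)
    have h2 := hi (j + k + 2) (by omega)
    have e1 := h 0
    have e2 := h 1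
    rw [show j + k + 1 - 1 = j + k by omega, h0] at h1
    rw [add_zero] at e1
    rw [show j + k + 2 - 1 = j + k + 1 by omega, e1] at h2
    rw [show j + k + 1 + 1 = j + k + 2 by omega] at e2
    rw [e1] at h1
    rw [e2] at h2
    rcases (show i = 0 ∨ i = 1 by omega) with rfl | rfl
    · rw [state_add_single_zero, state_inj] at h1
      omega
    · rw [state_add_single_one, state_inj] at h2
      omega

/-- Strong monopoly forces the eventual winner to be the first agent, and minimality of the monopoly
time forces the second agent to win the step just before. The offset 2 makes N the time before that
last win. -/
theorem IsPath.exists_mem_escapeForever {ω : Ω} (hω : IsPath x₀ fun n => X n ω)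
    (hs : ω ∈ sMon X 0) {N : ℕ} (hN : monopolyTime X ω = ((N + 2 : ℕ) : ℕ∞)) :
    ∃ j k, j + k = N ∧ ω ∈ escapeForever x₀ X j k := by
  obtain ⟨⟨-, i, hi⟩, hmin⟩ := (monopolyTime_eq_iff X ω _).1 hN
  have hi0 : i = 0 := by
    by_contra hne
    obtain rfl : i = 1 := by omega
    obtain ⟨L, hL⟩ := hs
    have h1 := hL (max L (N + 2)) (le_max_left _ _) 1 (by decide)
    have h2 := hL (max L (N + 2) + 1) (by have := le_max_left L (N + 2); omega) 1 (by decide)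
    have h3 := congrFun (hi (max L (N + 2) + 1) (by have := le_max_right L (N + 2); omega)) 1
    simp only [Nat.add_sub_cancel, Pi.add_apply, Pi.single_eq_same] at h3
    omega
  subst hi0
  have hstep : X (N + 1) ω = X N ω + Pi.single 1 1 := by
    refine (hω.2 N).resolve_left fun h => hmin (N + 1) (by omega) ⟨by omega, 0, fun m hm => ?_⟩
    rcases Nat.eq_or_lt_of_le hm with rfl | hm
    · exact h
    · exact hi m hm
  obtain ⟨j, k, hjk, hst⟩ := hω.exists_state N
  refine ⟨j, k, hjk, by rw [hjk]; exact hst, fun m => ?_⟩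
  rw [hjk]
  induction m with
  | zero =>
    change X N ω = _ at hst
    rw [add_zero, hstep, hst, state_add_single_one, add_zero]
  | succ m ih =>
    rw [hi (N + 1 + (m + 1)) (by omega), show N + 1 + (m + 1) - 1 = N + 1 + m by omega, ih,
      state_add_single_zero, add_assoc]

end TwoAgents

/-! ### Probabilities of the escape events -/

section Probabilities

variable {Ω : Type*} [MeasurableSpace Ω] {μ : Measure Ω} {F : Fin 2 → ℕ → ℝ} {x₀ : Fin 2 → ℕ}
  {X : ℕ → Ω → Fin 2 → ℕ}

theorem IsUrn.measurableSet_escape (hX : IsUrn μ F x₀ X) (j k M : ℕ) :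
    MeasurableSet (escape x₀ X j k M) := by
  have : escape x₀ X j k M = {ω | X (j + k) ω = state x₀ j k} ∩
      ⋂ m, ⋂ (_ : m ≤ M), {ω | X (j + k + 1 + m) ω = state x₀ (j + m) (k + 1)} := by
    ext ω
    simp only [Set.mem_inter_iff, Set.mem_iInter]
    rfl
  rw [this]
  exact (hX.measurableSet_eq _ _).inter <| MeasurableSet.iInter fun m =>
    MeasurableSet.iInter fun _ => hX.measurableSet_eq _ _

theorem IsUrn.measurableSet_escapeForever (hX : IsUrn μ F x₀ X) (j k : ℕ) :
    MeasurableSet (escapeForever x₀ X j k) := by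
  rw [escapeForever_eq_iInter]
  exact MeasurableSet.iInter fun M => hX.measurableSet_escape j k M

theorem IsUrn.measurableSet_sMon (hX : IsUrn μ F x₀ X) (i : Fin 2) :
    MeasurableSet (sMon X i) := by
  have : sMon X i = ⋃ N : ℕ, ⋂ n, ⋂ (_ : n ≥ N), ⋂ j, ⋂ (_ : j ≠ i), {ω | X n ω j = X N ω j} := by
    ext ω
    simp only [Set.mem_iUnion, Set.mem_iInter]
    rfl
  rw [this]
  refine MeasurableSet.iUnion fun N => MeasurableSet.iInter fun n => MeasurableSet.iInter fun _ =>
    MeasurableSet.iInter fun j => MeasurableSet.iInter fun _ => ?_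
  exact measurableSet_eq_fun ((measurable_pi_apply j).comp (hX.measurable n))
    ((measurable_pi_apply j).comp (hX.measurable N))

theorem IsUrn.measureReal_escape (hX : IsUrn μ F x₀ X)
    (hF : ∀ i k, 1 ≤ k → 0 < F i k) (hx₀ : ∀ i, 1 ≤ x₀ i) (j k M : ℕ) :
    μ.real (escape x₀ X j k M) =
      visitProb μ x₀ X j k * (F 1 (x₀ 1 + k) / (F 0 (x₀ 0 + j) + F 1 (x₀ 1 + k))) *
      ∏ m ∈ Finset.range M,
        F 0 (x₀ 0 + j + m) / (F 0 (x₀ 0 + j + m) + F 1 (x₀ 1 + (k + 1))) := by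
  induction M with
  | zero =>
    have h := (hX.measureReal_inter_step hF hx₀ (j + k) (E := {ω | X (j + k) ω = state x₀ j k})
      (j := j) (k := k) (fun ω ω' h hω => (h _ le_rfl).symm.trans hω) (fun ω h => h)).2
    rw [Finset.range_zero, Finset.prod_empty, mul_one, visitProb, ← h]
    congr 1
    ext ω
    refine and_congr_right fun _ => ⟨fun h => h 0 le_rfl, fun h m hm => ?_⟩
    obtain rfl : m = 0 := by omega
    exact h
  | succ M ih =>
    have h := (hX.measureReal_inter_step hF hx₀ (j + k + 1 + M) (E := escape x₀ X j k M)
      (j := j + M) (k := k + 1) (fun ω ω' h hω => ?_) (fun ω h => h.2 M le_rfl)).1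
    · rw [Finset.prod_range_succ, ← mul_assoc, ← ih, add_assoc (x₀ 0), ← h]
      congr 1
      ext ω
      constructor
      · exact fun h => ⟨⟨h.1, fun m hm => h.2 m (by omega)⟩, h.2 (M + 1) le_rfl⟩
      · rintro ⟨⟨h1, h2⟩, h3⟩
        refine ⟨h1, fun m hm => ?_⟩
        rcases Nat.eq_or_lt_of_le hm with rfl | hm
        · exact h3
        · exact h2 m (by omega)
    · refine ⟨(h _ (by omega)).symm.trans hω.1, fun m hm => ?_⟩
      exact (h _ (by omega)).symm.trans (hω.2 m hm)

/-- The escape events on one antidiagonal are disjoint, since they prescribe different states at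
time N. -/
theorem IsUrn.measureReal_sMon_inter [IsProbabilityMeasure μ] (hX : IsUrn μ F x₀ X)
    (hF : ∀ i k, 1 ≤ k → 0 < F i k) (hx₀ : ∀ i, 1 ≤ x₀ i) (N : ℕ) :
    μ.real (sMon X 0 ∩ {ω | monopolyTime X ω = ((N + 2 : ℕ) : ℕ∞)}) =
      ∑ j ∈ Finset.range (N + 1), μ.real (escapeForever x₀ X j (N - j)) := by
  rw [← measureReal_biUnion_finset]
  · refine measureReal_congr ?_
    filter_upwards [hX.ae_isPath hF hx₀] with ω hω
    refine propext ⟨fun h => ?_, fun h => ?_⟩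
    · obtain ⟨j, k, hjk, hmem⟩ := hω.exists_mem_escapeForever h.1 h.2
      obtain rfl : k = N - j := by omega
      exact Set.mem_biUnion (x := j) (by simp; omega) hmem
    · obtain ⟨j, hj, hmem⟩ := Set.mem_iUnion₂.1 h
      refine ⟨escapeForever_subset_sMon _ _ hmem, ?_⟩
      have hj' := Finset.mem_range.1 hj
      have := monopolyTime_of_mem_escapeForever hmem
      rwa [show j + (N - j) + 2 = N + 2 by omega] at this
  · intro j hj j' hj' hne
    refine Set.disjoint_left.2 fun ω h h' => hne ?_
    have hj := Finset.mem_range.1 hj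
    have hj' := Finset.mem_range.1 hj'
    have e := h.1
    rw [show j + (N - j) = N by omega] at e
    have e' := h'.1
    rw [show j' + (N - j') = N by omega, e, state_inj] at e'
    exact e'.1
  · exact fun q _ => hX.measurableSet_escapeForever _ _

end Probabilities

/-! ### Two-sided bounds for power-law feedback -/

section PowerFeedback

theorem powerFeedback_pos {α b : ℝ} (hα : 0 < α) {k : ℕ} (hk : 1 ≤ k) :
    0 < powerFeedback α b k := by
  have : (0 : ℝ) < k := by exact_mod_cast hk
  unfold powerFeedback
  positivity

theorem powerFeedback_mono {α b : ℝ} (hα : 0 < α) (hb : 0 ≤ b) {k l : ℕ} (h : k ≤ l) :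
    powerFeedback α b k ≤ powerFeedback α b l := by
  unfold powerFeedback
  gcongr

theorem summable_one_div_powerFeedback {α b : ℝ} (hb : 1 < b) (a : ℕ) :
    Summable fun j => 1 / powerFeedback α b (a + j) := by
  have h := ((Real.summable_one_div_nat_rpow.2 hb).mul_left (1 / α))
  have h' := (summable_nat_add_iff a).2 h
  refine h'.congr fun j => ?_
  rw [powerFeedback, one_div_mul_one_div, add_comm a j]

variable {Ω : Type*} [MeasurableSpace Ω] {μ : Measure Ω} [IsProbabilityMeasure μ]
  {α b : Fin 2 → ℝ} {x₀ : Fin 2 → ℕ} {X : ℕ → Ω → Fin 2 → ℕ}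

theorem IsUrn.exists_le_measureReal_escapeForever
    (hX : IsUrn μ (fun i => powerFeedback (α i) (b i)) x₀ X)
    (hα : ∀ i, 0 < α i) (hb : ∀ i, 1 < b i) (hx₀ : ∀ i, 1 ≤ x₀ i) :
    ∃ c C : ℝ, 0 < c ∧ 0 < C ∧ ∀ j k : ℕ,
      c * ((j : ℝ) + 1) ^ (-b 0) *
        Real.exp (-(C * (((k : ℝ) + 1) ^ b 1 * ((j : ℝ) + 1) ^ (1 - b 0)))) ≤
      μ.real (escapeForever x₀ X j k) := by
  have hF : ∀ i k, 1 ≤ k → 0 < powerFeedback (α i) (b i) k :=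
    fun i k hk => powerFeedback_pos (hα i) hk
  obtain ⟨m, M, hm, hw⟩ := hX.exists_visitProb_bounds hF hx₀
    (summable_one_div_powerFeedback (hb 0) _) (summable_one_div_powerFeedback (hb 1) _)
  have hα0 := hα 0
  have hα1 := hα 1
  have hb0 := hb 0
  have hb1 := hb 1
  have hx0 : (1 : ℝ) ≤ x₀ 0 := by exact_mod_cast hx₀ 0
  have hb0' : 0 < b 0 - 1 := by linarith
  refine ⟨m / (α 0 * (x₀ 0 : ℝ) ^ b 0),
    α 1 * ((x₀ 1 : ℝ) + 1) ^ b 1 * (1 / α 0 * (2 ^ b 0 / (b 0 - 1))),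
    by positivity, by positivity, fun j k => ?_⟩
  have hlim : Tendsto (fun M => μ.real (escape x₀ X j k M)) atTop
      (𝓝 (μ.real (escapeForever x₀ X j k))) := by
    rw [escapeForever_eq_iInter]
    exact (ENNReal.tendsto_toReal (measure_ne_top _ _)).comp
      (tendsto_measure_iInter_atTop (fun M => (hX.measurableSet_escape j k M).nullMeasurableSet)
        (antitone_escape j k) ⟨0, measure_ne_top _ _⟩)
  refine ge_of_tendsto' hlim fun L => ?_
  rw [hX.measureReal_escape hF hx₀]
  have hf : ∀ l, 0 < powerFeedback (α 0) (b 0) (x₀ 0 + j + l) :=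
    fun l => hF 0 _ (by have := hx₀ 0; omega)
  have hg : ∀ l, 0 < powerFeedback (α 1) (b 1) (x₀ 1 + l) :=
    fun l => hF 1 _ (by have := hx₀ 1; omega)
  have hf0 : 0 < powerFeedback (α 0) (b 0) (x₀ 0 + j) := hf 0
  have hg0 := hg k
  have hA : (0 : ℝ) < (j : ℝ) + 1 := by positivity
  have hprod := exp_le_prod_div hf (hg (k + 1)).le L
  refine mul_le_mul ?_ (le_trans (Real.exp_le_exp.2 ?_) hprod) (Real.exp_pos _).le
    (mul_nonneg measureReal_nonneg (by positivity))
  -- The two factors before the product equal w/f_j: the rate of the second agent cancels.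
  · have h1 : powerFeedback (α 0) (b 0) (x₀ 0 + j) ≤
        α 0 * (x₀ 0 : ℝ) ^ b 0 * ((j : ℝ) + 1) ^ b 0 := by
      unfold powerFeedback
      rw [mul_assoc, ← Real.mul_rpow (by positivity) hA.le]
      gcongr
      push_cast
      nlinarith [(Nat.cast_nonneg j : (0 : ℝ) ≤ j)]
    calc m / (α 0 * (x₀ 0 : ℝ) ^ b 0) * ((j : ℝ) + 1) ^ (-b 0)
        = m / (α 0 * (x₀ 0 : ℝ) ^ b 0 * ((j : ℝ) + 1) ^ b 0) := by
          rw [Real.rpow_neg hA.le]; field_simp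
      _ ≤ m / powerFeedback (α 0) (b 0) (x₀ 0 + j) := by gcongr
      _ ≤ visitProb μ x₀ X j k * (powerFeedback (α 0) (b 0) (x₀ 0 + j) *
            powerFeedback (α 1) (b 1) (x₀ 1 + k) / (powerFeedback (α 0) (b 0) (x₀ 0 + j) +
            powerFeedback (α 1) (b 1) (x₀ 1 + k))) /
            powerFeedback (α 0) (b 0) (x₀ 0 + j) := by gcongr; exact (hw j k).1
      _ = _ := by field_simp
  · rw [neg_le_neg_iff]
    have hS : ∑ l ∈ Finset.range L, 1 / powerFeedback (α 0) (b 0) (x₀ 0 + j + l) ≤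
        1 / α 0 * (2 ^ b 0 / (b 0 - 1)) * ((j : ℝ) + 1) ^ (1 - b 0) := by
      have h2 : ∀ l, 1 / powerFeedback (α 0) (b 0) (x₀ 0 + j + l) =
          1 / α 0 * ((x₀ 0 + j + l : ℕ) : ℝ) ^ (-b 0) := by
        intro l
        rw [powerFeedback, Real.rpow_neg (by positivity), ← one_div, one_div_mul_one_div]
      rw [Finset.sum_congr rfl fun l _ => h2 l, ← Finset.mul_sum, mul_assoc]
      have h3 := sum_rpow_neg_le hb0 (a := x₀ 0 + j) (by have := hx₀ 0; omega) L
      gcongr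
      refine h3.trans ?_
      gcongr ?_ * ?_
      refine Real.rpow_le_rpow_of_nonpos hA ?_ (by linarith)
      push_cast
      linarith
    have hG : powerFeedback (α 1) (b 1) (x₀ 1 + (k + 1)) ≤
        α 1 * ((x₀ 1 : ℝ) + 1) ^ b 1 * ((k : ℝ) + 1) ^ b 1 := by
      unfold powerFeedback
      rw [mul_assoc, ← Real.mul_rpow (by positivity) (by positivity)]
      gcongr
      push_cast
      nlinarith [(Nat.cast_nonneg k : (0 : ℝ) ≤ k), (Nat.cast_nonneg (x₀ 1) : (0 : ℝ) ≤ x₀ 1)]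
    calc _ ≤ (α 1 * ((x₀ 1 : ℝ) + 1) ^ b 1 * ((k : ℝ) + 1) ^ b 1) *
          (1 / α 0 * (2 ^ b 0 / (b 0 - 1)) * ((j : ℝ) + 1) ^ (1 - b 0)) := by
          gcongr
          exact Finset.sum_nonneg fun l _ => by have := hf l; positivity
      _ = _ := by ring

/-- Keeping only p(x₀ + j) of the first agent's subsequent wins already gives decay of order p:
during them its count stays below (p+1)(x₀ + j), so its rates remain comparable to f_j. -/
theorem IsUrn.exists_measureReal_escapeForever_le
    (hX : IsUrn μ (fun i => powerFeedback (α i) (b i)) x₀ X)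
    (hα : ∀ i, 0 < α i) (hb : ∀ i, 1 < b i) (hx₀ : ∀ i, 1 ≤ x₀ i) (p : ℕ) :
    ∃ C : ℝ, 0 < C ∧ ∀ j k : ℕ, μ.real (escapeForever x₀ X j k) ≤
      C * ((j : ℝ) + 1) ^ (-b 0) * (((j : ℝ) + 1) ^ (b 0 - 1) * ((k : ℝ) + 1) ^ (-b 1)) ^ p := by
  have hF : ∀ i k, 1 ≤ k → 0 < powerFeedback (α i) (b i) k :=
    fun i k hk => powerFeedback_pos (hα i) hk
  obtain ⟨m, M, hm, hw⟩ := hX.exists_visitProb_bounds hF hx₀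
    (summable_one_div_powerFeedback (hb 0) _) (summable_one_div_powerFeedback (hb 1) _)
  have hM : 0 < M := hm.trans_le ((hw 0 0).1.trans (hw 0 0).2)
  have hα0 := hα 0
  have hα1 := hα 1
  have hb0 := hb 0
  have hb1 := hb 1
  have hx0 : (1 : ℝ) ≤ x₀ 0 := by exact_mod_cast hx₀ 0
  refine ⟨M / α 0 * (α 0 / α 1 * ((p : ℝ) + 1) ^ b 0 * (x₀ 0 : ℝ) ^ (b 0 - 1)) ^ p,
    by positivity, fun j k => ?_⟩
  have hsub : escapeForever x₀ X j k ⊆ escape x₀ X j k ((x₀ 0 + j) * p) := by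
    rw [escapeForever_eq_iInter]
    exact Set.iInter_subset _ _
  refine (measureReal_mono hsub).trans ?_
  rw [hX.measureReal_escape hF hx₀]
  have hf : ∀ l, 0 < powerFeedback (α 0) (b 0) (x₀ 0 + j + l) :=
    fun l => hF 0 _ (by have := hx₀ 0; omega)
  have hg : ∀ l, 0 < powerFeedback (α 1) (b 1) (x₀ 1 + l) :=
    fun l => hF 1 _ (by have := hx₀ 1; omega)
  have hf0 : 0 < powerFeedback (α 0) (b 0) (x₀ 0 + j) := hf 0
  have hg0 := hg k
  have hA : (0 : ℝ) < (j : ℝ) + 1 := by positivity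
  have hB : (0 : ℝ) < (k : ℝ) + 1 := by positivity
  have hprod := prod_div_le (a := x₀ 0 + j) (p := p)
    (K := powerFeedback (α 0) (b 0) ((x₀ 0 + j) * (p + 1))) hf (hg (k + 1))
    (by have := hx₀ 0; omega) (fun l hl => powerFeedback_mono hα0 (by linarith) (by
      rw [mul_add, mul_one]; omega))
  have h1 : visitProb μ x₀ X j k * (powerFeedback (α 1) (b 1) (x₀ 1 + k) /
      (powerFeedback (α 0) (b 0) (x₀ 0 + j) + powerFeedback (α 1) (b 1) (x₀ 1 + k))) ≤
      M / α 0 * ((j : ℝ) + 1) ^ (-b 0) := by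
    have h2 : α 0 * ((j : ℝ) + 1) ^ b 0 ≤ powerFeedback (α 0) (b 0) (x₀ 0 + j) := by
      unfold powerFeedback
      gcongr
      push_cast
      linarith
    calc _ = visitProb μ x₀ X j k * (powerFeedback (α 0) (b 0) (x₀ 0 + j) *
            powerFeedback (α 1) (b 1) (x₀ 1 + k) / (powerFeedback (α 0) (b 0) (x₀ 0 + j) +
            powerFeedback (α 1) (b 1) (x₀ 1 + k))) /
            powerFeedback (α 0) (b 0) (x₀ 0 + j) := by field_simp
      _ ≤ M / powerFeedback (α 0) (b 0) (x₀ 0 + j) := by gcongr; exact (hw j k).2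
      _ ≤ M / (α 0 * ((j : ℝ) + 1) ^ b 0) := by gcongr
      _ = _ := by rw [Real.rpow_neg hA.le]; field_simp
  have h3 : powerFeedback (α 0) (b 0) ((x₀ 0 + j) * (p + 1)) /
      (((x₀ 0 + j : ℕ) : ℝ) * powerFeedback (α 1) (b 1) (x₀ 1 + (k + 1))) ≤
      (α 0 / α 1 * ((p : ℝ) + 1) ^ b 0 * (x₀ 0 : ℝ) ^ (b 0 - 1)) *
        (((j : ℝ) + 1) ^ (b 0 - 1) * ((k : ℝ) + 1) ^ (-b 1)) := by
    have ha : (0 : ℝ) < ((x₀ 0 + j : ℕ) : ℝ) := by push_cast; positivity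
    have h4 : ((x₀ 0 + j : ℕ) : ℝ) ^ (b 0 - 1) ≤ (x₀ 0 : ℝ) ^ (b 0 - 1) *
        ((j : ℝ) + 1) ^ (b 0 - 1) := by
      rw [← Real.mul_rpow (by positivity) hA.le]
      refine Real.rpow_le_rpow ha.le ?_ (by linarith)
      push_cast
      nlinarith [(Nat.cast_nonneg j : (0 : ℝ) ≤ j)]
    have h5 : α 1 * ((k : ℝ) + 1) ^ b 1 ≤ powerFeedback (α 1) (b 1) (x₀ 1 + (k + 1)) := by
      unfold powerFeedback
      gcongr
      push_cast
      linarith [(Nat.cast_nonneg (x₀ 1) : (0 : ℝ) ≤ x₀ 1)]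
    have h6 : powerFeedback (α 0) (b 0) ((x₀ 0 + j) * (p + 1)) =
        α 0 * ((p : ℝ) + 1) ^ b 0 * (((x₀ 0 + j : ℕ) : ℝ) * ((x₀ 0 + j : ℕ) : ℝ) ^ (b 0 - 1)) := by
      unfold powerFeedback
      rw [Nat.cast_mul, Real.mul_rpow (by positivity) (by positivity), Real.rpow_sub_one ha.ne']
      push_cast
      field_simp
    rw [h6]
    calc _ ≤ α 0 * ((p : ℝ) + 1) ^ b 0 * (((x₀ 0 + j : ℕ) : ℝ) *
          ((x₀ 0 : ℝ) ^ (b 0 - 1) * ((j : ℝ) + 1) ^ (b 0 - 1))) /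
          (((x₀ 0 + j : ℕ) : ℝ) * (α 1 * ((k : ℝ) + 1) ^ b 1)) := by gcongr
      _ = _ := by rw [Real.rpow_neg hB.le]; field_simp
  refine (mul_le_mul h1 hprod (Finset.prod_nonneg fun l _ => ?_) (by positivity)).trans ?_
  · have := hf l
    have := hg (k + 1)
    positivity
  · calc _ ≤ M / α 0 * ((j : ℝ) + 1) ^ (-b 0) *
          ((α 0 / α 1 * ((p : ℝ) + 1) ^ b 0 * (x₀ 0 : ℝ) ^ (b 0 - 1)) *
          (((j : ℝ) + 1) ^ (b 0 - 1) * ((k : ℝ) + 1) ^ (-b 1))) ^ p := by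
          have := hF 0 ((x₀ 0 + j) * (p + 1)) (by have := hx₀ 0; nlinarith)
          have := hg (k + 1)
          gcongr
      _ = _ := by rw [mul_pow]; ring

end PowerFeedback

/-! ### Summation along the antidiagonal j + k = N -/

section SumAsymptotics

/-- At most D indices lie below the cutoff; above it the sum is a power tail starting at ⌈D⌉. -/
theorem sum_truncated_rpow_le {b : ℝ} (hb : 1 < b) {D x y : ℝ} (hD : 0 < D) (hx : 0 ≤ x)
    (hy : 0 ≤ y) (L : ℕ) :
    ∑ j ∈ Finset.range L, (if (j : ℝ) + 1 ≤ D then x else y * ((j : ℝ) + 1) ^ (-b)) ≤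
      D * x + 2 ^ b / (b - 1) * (y * D ^ (1 - b)) := by
  have hb' : 0 < b - 1 := by linarith
  rw [Finset.sum_ite]
  refine add_le_add ?_ ?_
  · rw [Finset.sum_const, nsmul_eq_mul]
    gcongr
    have hsub : (Finset.range L).filter (fun j : ℕ => (j : ℝ) + 1 ≤ D) ⊆
        Finset.range ⌊D⌋₊ := by
      intro j hj
      have := (Finset.mem_filter.1 hj).2
      rw [Finset.mem_range, Nat.lt_iff_add_one_le, Nat.le_floor_iff hD.le]
      exact_mod_cast this
    calc _ ≤ ((Finset.range ⌊D⌋₊).card : ℝ) := by exact_mod_cast Finset.card_le_card hsub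
      _ ≤ D := by rw [Finset.card_range]; exact Nat.floor_le hD.le
  · have hc : 1 ≤ ⌈D⌉₊ := Nat.one_le_iff_ne_zero.2 (Nat.ceil_pos.2 hD).ne'
    have hsub : (Finset.range L).filter (fun j : ℕ => ¬ (j : ℝ) + 1 ≤ D) ⊆
        (Finset.range L).image (fun m => ⌈D⌉₊ + m - 1) := by
      intro j hj
      obtain ⟨h1, h2⟩ := Finset.mem_filter.1 hj
      have h1 := Finset.mem_range.1 h1
      have h3 : ⌈D⌉₊ ≤ j + 1 := by
        rw [Nat.ceil_le]; push_cast; linarith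
      exact Finset.mem_image.2 ⟨j + 1 - ⌈D⌉₊, Finset.mem_range.2 (by omega), by omega⟩
    calc _ ≤ ∑ j ∈ (Finset.range L).image (fun m => ⌈D⌉₊ + m - 1),
          y * ((j : ℝ) + 1) ^ (-b) :=
          Finset.sum_le_sum_of_subset_of_nonneg hsub fun _ _ _ => by positivity
      _ = ∑ m ∈ Finset.range L, y * ((⌈D⌉₊ + m : ℕ) : ℝ) ^ (-b) := by
          rw [Finset.sum_image (fun m _ m' _ h => by omega)]
          refine Finset.sum_congr rfl fun m _ => ?_
          have : ((⌈D⌉₊ + m - 1 : ℕ) : ℝ) + 1 = ((⌈D⌉₊ + m : ℕ) : ℝ) := by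
            rw [Nat.cast_sub (by omega)]; push_cast; ring
          rw [this]
      _ ≤ y * (2 ^ b / (b - 1) * (⌈D⌉₊ : ℝ) ^ (1 - b)) := by
          rw [← Finset.mul_sum]
          gcongr
          exact sum_rpow_neg_le hb hc L
      _ ≤ y * (2 ^ b / (b - 1) * D ^ (1 - b)) := by
          gcongr ?_ * (?_ * ?_)
          exact Real.rpow_le_rpow_of_nonpos hD (Nat.le_ceil D) (by linarith)
      _ = _ := by ring

variable {b s : ℝ} {e : ℕ → ℕ → ℝ}

/-- The contribution of pairs with `k ≥ n / 2`. -/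
theorem exists_bound_of_half_le_right (hb : 1 < b) (hs : 0 < s)
    (hup : ∀ p : ℕ, ∃ C : ℝ, 0 < C ∧ ∀ j k : ℕ, e j k ≤
      C * ((j : ℝ) + 1) ^ (-b) * (((j : ℝ) + 1) ^ (b - 1) * ((k : ℝ) + 1) ^ (-s)) ^ p) :
    ∃ C : ℝ, 0 < C ∧ ∀ N : ℕ, ∃ G : ℕ → ℝ, (∀ j, 0 ≤ G j) ∧
      (∀ j k : ℕ, (N : ℝ) + 2 ≤ 2 * ((k : ℝ) + 1) → e j k ≤ G j) ∧
      ∑ j ∈ Finset.range (N + 1), G j ≤ C * ((N : ℝ) + 2) ^ (-s) := by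
  have hr : 0 < b - 1 := by linarith
  -- With this p the exponent of j+1 in the bound is nonnegative, so below the cutoff D the bound is
  -- largest at D.
  obtain ⟨p, hp⟩ := exists_nat_ge (b / (b - 1))
  have hp' : 0 ≤ -b + (b - 1) * p := by
    rw [div_le_iff₀ hr] at hp; linarith
  obtain ⟨C₀, hC₀, h₀⟩ := hup 0
  obtain ⟨C₁, hC₁, h₁⟩ := hup p
  refine ⟨C₁ * (2 ^ s) ^ p + 2 ^ b / (b - 1) * C₀, by positivity, fun N => ?_⟩
  set n : ℝ := (N : ℝ) + 2 with hn
  have hn0 : 0 < n := by positivity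
  -- The cutoff solves D^(b-1) = n^s, where the two available bounds have the same order.
  set D : ℝ := n ^ (s / (b - 1)) with hD
  have hD0 : 0 < D := by positivity
  refine ⟨fun j => if (j : ℝ) + 1 ≤ D then
      C₁ * D ^ (-b + (b - 1) * p) * ((2 ^ s) ^ p * n ^ (-s * p))
    else C₀ * ((j : ℝ) + 1) ^ (-b), fun j => by positivity, fun j k hk => ?_, ?_⟩
  · have hA : (0 : ℝ) < (j : ℝ) + 1 := by positivity
    have hB : (0 : ℝ) < (k : ℝ) + 1 := by positivity
    dsimp only
    split_ifs with hj
    · calc e j k ≤ _ := h₁ j k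
        _ = C₁ * ((j : ℝ) + 1) ^ (-b + (b - 1) * p) * (((k : ℝ) + 1) ^ (-s)) ^ p := by
          rw [mul_pow, Real.rpow_add hA, Real.rpow_mul hA.le, Real.rpow_natCast]; ring
        _ ≤ C₁ * D ^ (-b + (b - 1) * p) * (2 ^ s * n ^ (-s)) ^ p := by
          gcongr
          calc ((k : ℝ) + 1) ^ (-s) ≤ (n / 2) ^ (-s) :=
                Real.rpow_le_rpow_of_nonpos (by positivity) (by linarith) (by linarith)
            _ = 2 ^ s * n ^ (-s) := by
              rw [Real.div_rpow hn0.le (by norm_num), Real.rpow_neg (by norm_num : (0:ℝ) ≤ 2)]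
              field_simp
        _ = _ := by rw [mul_pow, Real.rpow_mul hn0.le, Real.rpow_natCast]
    · simpa using h₀ j k
  · refine (sum_truncated_rpow_le hb hD0 (by positivity) hC₀.le _).trans (le_of_eq ?_)
    have e1 : D ^ (1 - b) = n ^ (-s) := by
      rw [hD, ← Real.rpow_mul hn0.le]; congr 1; field_simp; ring
    have e2 : D * D ^ (-b + (b - 1) * p) = n ^ (-s + s * p) := by
      rw [← Real.rpow_one_add' hD0.le (by
        intro h
        have : 0 < 1 + (-b + (b - 1) * p) := by linarith
        linarith), hD, ← Real.rpow_mul hn0.le]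
      congr 1; field_simp; ring
    have e3 : n ^ (-s + s * p) * n ^ (-s * p) = n ^ (-s) := by
      rw [← Real.rpow_add hn0]; congr 1; ring
    rw [e1]
    calc _ = C₁ * (2 ^ s) ^ p * ((D * D ^ (-b + (b - 1) * p)) * n ^ (-s * p)) +
          2 ^ b / (b - 1) * C₀ * n ^ (-s) := by ring
      _ = _ := by rw [e2, e3]; ring

/-- The contribution of pairs with `j ≥ n / 2`, when it dominates. -/
theorem exists_bound_of_half_le_left (hb : 1 < b) (hs : 1 < s)
    (hup : ∀ p : ℕ, ∃ C : ℝ, 0 < C ∧ ∀ j k : ℕ, e j k ≤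
      C * ((j : ℝ) + 1) ^ (-b) * (((j : ℝ) + 1) ^ (b - 1) * ((k : ℝ) + 1) ^ (-s)) ^ p) :
    ∃ C : ℝ, 0 < C ∧ ∀ N : ℕ, ∃ G : ℕ → ℝ, (∀ k, 0 ≤ G k) ∧
      (∀ j k : ℕ, (N : ℝ) + 2 ≤ 2 * ((j : ℝ) + 1) → e j k ≤ G k) ∧
      ∑ k ∈ Finset.range (N + 1), G k ≤ C * ((N : ℝ) + 2) ^ ((b - 1) / s - b) := by
  have hs0 : 0 < s := by linarith
  have hs1 : 0 < s - 1 := by linarith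
  obtain ⟨C₀, hC₀, h₀⟩ := hup 0
  obtain ⟨C₁, hC₁, h₁⟩ := hup 1
  refine ⟨C₀ * 2 ^ b + 2 ^ s / (s - 1) * (C₁ * 2), by positivity, fun N => ?_⟩
  set n : ℝ := (N : ℝ) + 2 with hn
  have hn0 : 0 < n := by positivity
  -- The cutoff in k solves D^s = n^(b-1); beyond it p = 1 suffices because k^(-s) is summable.
  set D : ℝ := n ^ ((b - 1) / s) with hD
  have hD0 : 0 < D := by positivity
  refine ⟨fun k => if (k : ℝ) + 1 ≤ D then C₀ * (2 ^ b * n ^ (-b))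
    else C₁ * (2 * n⁻¹) * ((k : ℝ) + 1) ^ (-s), fun j => by positivity, fun j k hk => ?_, ?_⟩
  · have hA : (0 : ℝ) < (j : ℝ) + 1 := by positivity
    have hB : (0 : ℝ) < (k : ℝ) + 1 := by positivity
    dsimp only
    split_ifs with hj
    · calc e j k ≤ C₀ * ((j : ℝ) + 1) ^ (-b) := by simpa using h₀ j k
        _ ≤ C₀ * (n / 2) ^ (-b) := by
          gcongr ?_ * ?_
          exact Real.rpow_le_rpow_of_nonpos (by positivity) (by linarith) (by linarith)
        _ = C₀ * (2 ^ b * n ^ (-b)) := by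
          rw [Real.div_rpow hn0.le (by norm_num), Real.rpow_neg (by norm_num : (0:ℝ) ≤ 2)]
          field_simp
    · calc e j k ≤ _ := h₁ j k
        _ = C₁ * ((j : ℝ) + 1)⁻¹ * ((k : ℝ) + 1) ^ (-s) := by
          have : ((j : ℝ) + 1) ^ (-b) * ((j : ℝ) + 1) ^ (b - 1) = ((j : ℝ) + 1)⁻¹ := by
            rw [← Real.rpow_add hA, ← Real.rpow_neg_one]; congr 1; ring
          rw [pow_one, ← this]; ring
        _ ≤ _ := by
          gcongr
          rw [inv_le_comm₀ hA (by positivity), mul_inv, inv_inv]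
          linarith
  · refine (sum_truncated_rpow_le hs hD0 (by positivity) (by positivity) _).trans (le_of_eq ?_)
    have e1 : D * n ^ (-b) = n ^ ((b - 1) / s - b) := by
      rw [hD, ← Real.rpow_add hn0]; congr 1
    have e2 : n⁻¹ * D ^ (1 - s) = n ^ ((b - 1) / s - b) := by
      rw [hD, ← Real.rpow_mul hn0.le, ← Real.rpow_neg_one, ← Real.rpow_add hn0]
      congr 1; field_simp; ring
    calc _ = C₀ * 2 ^ b * (D * n ^ (-b)) +
          2 ^ s / (s - 1) * (C₁ * 2) * (n⁻¹ * D ^ (1 - s)) := by ring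
      _ = _ := by rw [e1, e2]; ring

theorem exists_sum_le_of_le (hb : 1 < b) (hs : 1 < s) (hbs : b ≤ s + 1)
    (hup : ∀ p : ℕ, ∃ C : ℝ, 0 < C ∧ ∀ j k : ℕ, e j k ≤
      C * ((j : ℝ) + 1) ^ (-b) * (((j : ℝ) + 1) ^ (b - 1) * ((k : ℝ) + 1) ^ (-s)) ^ p) :
    ∃ C : ℝ, 0 < C ∧ ∀ N : ℕ, ∑ j ∈ Finset.range (N + 1), e j (N - j) ≤
      C * ((N : ℝ) + 2) ^ ((b - 1) / s - b) := by
  obtain ⟨C₁, hC₁, h₁⟩ := exists_bound_of_half_le_right hb (by linarith) hup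
  obtain ⟨C₂, hC₂, h₂⟩ := exists_bound_of_half_le_left hb hs hup
  refine ⟨C₁ + C₂, by positivity, fun N => ?_⟩
  obtain ⟨G₁, hG₁, hb₁, hs₁⟩ := h₁ N
  obtain ⟨G₂, hG₂, hb₂, hs₂⟩ := h₂ N
  -- The right-half contribution n^(-s) is absorbed precisely because b ≤ s + 1.
  have hexp : -s ≤ (b - 1) / s - b := by
    have hs0 : 0 < s := by linarith
    have : 0 ≤ (s - 1) * (s - (b - 1)) / s := by
      have : 0 ≤ (s - 1) * (s - (b - 1)) := mul_nonneg (by linarith) (by linarith)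
      positivity
    have h' : (s - 1) * (s - (b - 1)) / s = (b - 1) / s - b + s := by field_simp; ring
    linarith
  calc ∑ j ∈ Finset.range (N + 1), e j (N - j)
      ≤ ∑ j ∈ Finset.range (N + 1), (G₁ j + G₂ (N - j)) := by
        refine Finset.sum_le_sum fun j hj => ?_
        have hj := Finset.mem_range.1 hj
        rcases le_total j (N - j) with h | h
        · have : (N : ℝ) + 2 ≤ 2 * (((N - j : ℕ) : ℝ) + 1) := by
            have : N + 2 ≤ 2 * ((N - j) + 1) := by omega
            exact_mod_cast this
          linarith [hb₁ j (N - j) this, hG₂ (N - j)]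
        · have : (N : ℝ) + 2 ≤ 2 * ((j : ℝ) + 1) := by
            have : N + 2 ≤ 2 * (j + 1) := by omega
            exact_mod_cast this
          linarith [hb₂ j (N - j) this, hG₁ j]
    _ = ∑ j ∈ Finset.range (N + 1), G₁ j + ∑ k ∈ Finset.range (N + 1), G₂ k := by
        rw [Finset.sum_add_distrib, Finset.sum_flip]
    _ ≤ C₁ * ((N : ℝ) + 2) ^ (-s) + C₂ * ((N : ℝ) + 2) ^ ((b - 1) / s - b) := add_le_add hs₁ hs₂
    _ ≤ C₁ * ((N : ℝ) + 2) ^ ((b - 1) / s - b) + C₂ * ((N : ℝ) + 2) ^ ((b - 1) / s - b) := by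
        gcongr
        linarith [(Nat.cast_nonneg N : (0 : ℝ) ≤ N)]
    _ = _ := by ring

theorem exists_sum_le_of_ge (hb : 1 < b) (hs : 1 < s) (hbs : s + 1 ≤ b)
    (hup : ∀ p : ℕ, ∃ C : ℝ, 0 < C ∧ ∀ j k : ℕ, e j k ≤
      C * ((j : ℝ) + 1) ^ (-b) * (((j : ℝ) + 1) ^ (b - 1) * ((k : ℝ) + 1) ^ (-s)) ^ p) :
    ∃ C : ℝ, 0 < C ∧ ∀ N : ℕ, ∑ j ∈ Finset.range (N + 1), e j (N - j) ≤
      C * ((N : ℝ) + 2) ^ (-s) := by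
  obtain ⟨C₁, hC₁, h₁⟩ := exists_bound_of_half_le_right hb (by linarith) hup
  obtain ⟨C₀, hC₀, h₀⟩ := hup 0
  have hr : 0 < b - 1 := by linarith
  refine ⟨C₁ + 2 ^ b / (b - 1) * (C₀ * 4 ^ (b - 1)), by positivity, fun N => ?_⟩
  obtain ⟨G₁, hG₁, hb₁, hs₁⟩ := h₁ N
  have hn1 : (1 : ℝ) ≤ (N : ℝ) + 2 := by linarith [(Nat.cast_nonneg N : (0 : ℝ) ≤ N)]
  have hn0 : (0 : ℝ) < (N : ℝ) + 2 := by positivity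
  -- Cutting at n/4, strictly below n/2, leaves every term with j+1 ≥ n/2 in the tail.
  have htail := sum_truncated_rpow_le hb (D := ((N : ℝ) + 2) / 4) (x := 0) (y := C₀)
    (by positivity) le_rfl hC₀.le (N + 1)
  calc ∑ j ∈ Finset.range (N + 1), e j (N - j)
      ≤ ∑ j ∈ Finset.range (N + 1), (G₁ j +
          (if (j : ℝ) + 1 ≤ ((N : ℝ) + 2) / 4 then 0 else C₀ * ((j : ℝ) + 1) ^ (-b))) := by
        refine Finset.sum_le_sum fun j hj => ?_
        have hj := Finset.mem_range.1 hj
        rcases le_total j (N - j) with h | h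
        · have : (N : ℝ) + 2 ≤ 2 * (((N - j : ℕ) : ℝ) + 1) := by
            have : N + 2 ≤ 2 * ((N - j) + 1) := by omega
            exact_mod_cast this
          have h2 : 0 ≤ (if (j : ℝ) + 1 ≤ ((N : ℝ) + 2) / 4 then 0
              else C₀ * ((j : ℝ) + 1) ^ (-b)) := by
            split_ifs <;> positivity
          linarith [hb₁ j (N - j) this]
        · have : (N : ℝ) + 2 ≤ 2 * ((j : ℝ) + 1) := by
            have : N + 2 ≤ 2 * (j + 1) := by omega
            exact_mod_cast this
          rw [if_neg (by linarith)]
          have h3 := h₀ j (N - j)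
          rw [pow_zero, mul_one] at h3
          linarith [hG₁ j]
    _ ≤ C₁ * ((N : ℝ) + 2) ^ (-s) +
        2 ^ b / (b - 1) * (C₀ * (((N : ℝ) + 2) / 4) ^ (1 - b)) := by
        rw [Finset.sum_add_distrib]
        linarith
    _ = C₁ * ((N : ℝ) + 2) ^ (-s) +
        2 ^ b / (b - 1) * (C₀ * (4 ^ (b - 1) * ((N : ℝ) + 2) ^ (1 - b))) := by
        rw [Real.div_rpow hn0.le (by norm_num), show b - 1 = -(1 - b) by ring,
          Real.rpow_neg (by norm_num : (0 : ℝ) ≤ 4)]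
        field_simp
    _ ≤ C₁ * ((N : ℝ) + 2) ^ (-s) +
        2 ^ b / (b - 1) * (C₀ * (4 ^ (b - 1) * ((N : ℝ) + 2) ^ (-s))) := by
        gcongr
        linarith
    _ = _ := by ring

/-- On the block k < D/2 with D = n^((b-1)/s), the exponent in the lower bound stays bounded and j
is of order n; the block has about D/2 terms. -/
theorem exists_le_sum_of_le {c C : ℝ} (hc : 0 < c) (hC : 0 < C) (hb : 1 < b) (hs : 1 < s)
    (hbs : b ≤ s + 1) (he : ∀ j k, 0 ≤ e j k)
    (hlow : ∀ j k : ℕ, c * ((j : ℝ) + 1) ^ (-b) *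
      Real.exp (-(C * (((k : ℝ) + 1) ^ s * ((j : ℝ) + 1) ^ (1 - b)))) ≤ e j k) :
    ∃ c' : ℝ, 0 < c' ∧ ∀ N : ℕ, c' * ((N : ℝ) + 2) ^ ((b - 1) / s - b) ≤
      ∑ j ∈ Finset.range (N + 1), e j (N - j) := by
  have hs0 : 0 < s := by linarith
  have hr : 0 < b - 1 := by linarith
  refine ⟨1 / 2 * (c * Real.exp (-(C * (2 ^ s * 4 ^ (b - 1))))), by positivity, fun N => ?_⟩
  set n : ℝ := (N : ℝ) + 2 with hn
  have hn1 : (1 : ℝ) ≤ n := by linarith [(Nat.cast_nonneg N : (0 : ℝ) ≤ N)]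
  have hn0 : (0 : ℝ) < n := by positivity
  set D : ℝ := n ^ ((b - 1) / s) with hD
  have hD1 : 1 ≤ D := Real.one_le_rpow hn1 (by positivity)
  have hDn : D ≤ n := by
    calc D ≤ n ^ (1 : ℝ) :=
          Real.rpow_le_rpow_of_exponent_le hn1 (by rw [div_le_one hs0]; linarith)
      _ = n := Real.rpow_one n
  have hK : ⌈D / 2⌉₊ ≤ N + 1 := by
    rw [Nat.ceil_le]; push_cast; linarith [(Nat.cast_nonneg N : (0 : ℝ) ≤ N)]
  rw [← Finset.sum_flip]
  calc 1 / 2 * (c * Real.exp (-(C * (2 ^ s * 4 ^ (b - 1))))) * n ^ ((b - 1) / s - b)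
      = D / 2 * (c * n ^ (-b) * Real.exp (-(C * (2 ^ s * 4 ^ (b - 1))))) := by
        rw [sub_eq_add_neg _ b, Real.rpow_add hn0]; ring
    _ ≤ ⌈D / 2⌉₊ * (c * n ^ (-b) * Real.exp (-(C * (2 ^ s * 4 ^ (b - 1))))) := by
        gcongr; exact Nat.le_ceil _
    _ = ∑ k ∈ Finset.range ⌈D / 2⌉₊, c * n ^ (-b) *
          Real.exp (-(C * (2 ^ s * 4 ^ (b - 1)))) := by
        rw [Finset.sum_const, Finset.card_range, nsmul_eq_mul]
    _ ≤ ∑ k ∈ Finset.range ⌈D / 2⌉₊, e (N - k) (N - (N - k)) := by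
        refine Finset.sum_le_sum fun k hk => ?_
        have hk := Finset.mem_range.1 hk
        have hkD := Nat.lt_ceil.1 hk
        rw [show N - (N - k) = k by omega]
        refine le_trans ?_ (hlow (N - k) k)
        have hcast : ((N - k : ℕ) : ℝ) + 1 = n - 1 - k := by
          rw [Nat.cast_sub (by omega), hn]; ring
        have hA1 : (1 : ℝ) ≤ ((N - k : ℕ) : ℝ) + 1 := by
          linarith [(Nat.cast_nonneg (N - k) : (0 : ℝ) ≤ _)]
        have hA : n / 4 ≤ ((N - k : ℕ) : ℝ) + 1 := by linarith
        have hA' : ((N - k : ℕ) : ℝ) + 1 ≤ n := by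
          linarith [(Nat.cast_nonneg k : (0 : ℝ) ≤ k)]
        have hB : (k : ℝ) + 1 ≤ 2 * D := by linarith
        have hz : ((k : ℝ) + 1) ^ s * (((N - k : ℕ) : ℝ) + 1) ^ (1 - b) ≤
            2 ^ s * 4 ^ (b - 1) := by
          calc _ ≤ (2 * D) ^ s * (n / 4) ^ (1 - b) := by
                gcongr ?_ * ?_
                · gcongr
                · exact Real.rpow_le_rpow_of_nonpos (by positivity) hA (by linarith)
            _ = 2 ^ s * 4 ^ (b - 1) * (n ^ (b - 1) * n ^ (1 - b)) := by
                rw [Real.mul_rpow (by norm_num) (by positivity), hD, ← Real.rpow_mul hn0.le,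
                  div_mul_cancel₀ _ hs0.ne', Real.div_rpow hn0.le (by norm_num),
                  show b - 1 = -(1 - b) by ring, Real.rpow_neg (by norm_num : (0 : ℝ) ≤ 4)]
                field_simp
            _ = 2 ^ s * 4 ^ (b - 1) := by
                rw [← Real.rpow_add hn0]; simp
        gcongr ?_ * ?_ * ?_
        · exact Real.rpow_le_rpow_of_nonpos (by positivity) hA' (by linarith)
        · exact Real.exp_le_exp.2 (by gcongr)
    _ ≤ ∑ k ∈ Finset.range (N + 1), e (N - k) (N - (N - k)) :=
        Finset.sum_le_sum_of_subset_of_nonneg (Finset.range_mono hK) fun _ _ _ => he _ _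

/-- On a block of about D/4 indices j of order D = n^(s/(b-1)), the exponent stays bounded, and D ·
D^(-b) = n^(-s). -/
theorem exists_le_sum_of_ge {c C : ℝ} (hc : 0 < c) (hC : 0 < C) (hb : 1 < b) (hs : 1 < s)
    (hbs : s + 1 ≤ b) (he : ∀ j k, 0 ≤ e j k)
    (hlow : ∀ j k : ℕ, c * ((j : ℝ) + 1) ^ (-b) *
      Real.exp (-(C * (((k : ℝ) + 1) ^ s * ((j : ℝ) + 1) ^ (1 - b)))) ≤ e j k) :
    ∃ c' : ℝ, 0 < c' ∧ ∀ N : ℕ, 4 ≤ N → c' * ((N : ℝ) + 2) ^ (-s) ≤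
      ∑ j ∈ Finset.range (N + 1), e j (N - j) := by
  have hs0 : 0 < s := by linarith
  have hr : 0 < b - 1 := by linarith
  refine ⟨1 / 4 * (c * 3 ^ (-b) * Real.exp (-(C * 4 ^ (b - 1)))), by positivity,
    fun N hN => ?_⟩
  set n : ℝ := (N : ℝ) + 2 with hn
  have hN' : (4 : ℝ) ≤ N := by exact_mod_cast hN
  have hn1 : (1 : ℝ) ≤ n := by linarith
  have hn0 : (0 : ℝ) < n := by positivity
  set D : ℝ := n ^ (s / (b - 1)) with hD
  have hD1 : 1 ≤ D := Real.one_le_rpow hn1 (by positivity)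
  have hD0 : 0 < D := by positivity
  have hDn : D ≤ n := by
    calc D ≤ n ^ (1 : ℝ) :=
          Real.rpow_le_rpow_of_exponent_le hn1 (by rw [div_le_one hr]; linarith)
      _ = n := Real.rpow_one n
  set L := ⌈D / 4⌉₊ with hL
  have hL1 : D / 4 ≤ L := Nat.le_ceil _
  have hL2 : (L : ℝ) < D / 4 + 1 := Nat.ceil_lt_add_one (by positivity)
  -- From L < D/4 + 1 and D ≤ N + 2 one gets 2L < N/2 + 3, which is at most N + 1 once N ≥ 4.
  have hLN : 2 * L ≤ N + 1 := by
    have : (2 * L : ℝ) ≤ N + 1 := by linarith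
    exact_mod_cast this
  calc 1 / 4 * (c * 3 ^ (-b) * Real.exp (-(C * 4 ^ (b - 1)))) * n ^ (-s)
      = D / 4 * (c * (3 * D) ^ (-b) * Real.exp (-(C * 4 ^ (b - 1)))) := by
        have : n ^ (-s) = D * D ^ (-b) := by
          rw [hD, ← Real.rpow_mul hn0.le, ← Real.rpow_add hn0]
          congr 1; field_simp; ring
        rw [this, Real.mul_rpow (by norm_num) hD0.le]; ring
    _ ≤ L * (c * (3 * D) ^ (-b) * Real.exp (-(C * 4 ^ (b - 1)))) := by gcongr
    _ = ∑ j ∈ Finset.Ico L (2 * L), c * (3 * D) ^ (-b) * Real.exp (-(C * 4 ^ (b - 1))) := by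
        rw [Finset.sum_const, Nat.card_Ico, nsmul_eq_mul, show 2 * L - L = L by omega]
    _ ≤ ∑ j ∈ Finset.Ico L (2 * L), e j (N - j) := by
        refine Finset.sum_le_sum fun j hj => ?_
        obtain ⟨hj1, hj2⟩ := Finset.mem_Ico.1 hj
        refine le_trans ?_ (hlow j (N - j))
        have hj1' : (L : ℝ) ≤ j := by exact_mod_cast hj1
        have hj2' : (j : ℝ) + 1 ≤ 2 * L := by exact_mod_cast hj2
        have hA : D / 4 ≤ (j : ℝ) + 1 := by linarith
        have hA' : (j : ℝ) + 1 ≤ 3 * D := by linarith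
        have hB : ((N - j : ℕ) : ℝ) + 1 ≤ n := by
          have : ((N - j : ℕ) : ℝ) ≤ N := by exact_mod_cast Nat.sub_le _ _
          linarith
        have hz : (((N - j : ℕ) : ℝ) + 1) ^ s * ((j : ℝ) + 1) ^ (1 - b) ≤ 4 ^ (b - 1) := by
          calc _ ≤ n ^ s * (D / 4) ^ (1 - b) := by
                gcongr ?_ * ?_
                · gcongr
                · exact Real.rpow_le_rpow_of_nonpos (by positivity) hA (by linarith)
            _ = 4 ^ (b - 1) * (n ^ s * n ^ (-s)) := by
                have : D ^ (1 - b) = n ^ (-s) := by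
                  rw [hD, ← Real.rpow_mul hn0.le]; congr 1; field_simp; ring
                rw [Real.div_rpow hD0.le (by norm_num), this,
                  show b - 1 = -(1 - b) by ring, Real.rpow_neg (by norm_num : (0 : ℝ) ≤ 4)]
                field_simp
            _ = 4 ^ (b - 1) := by rw [← Real.rpow_add hn0]; simp
        gcongr ?_ * ?_ * ?_
        · exact Real.rpow_le_rpow_of_nonpos (by positivity) hA' (by linarith)
        · exact Real.exp_le_exp.2 (by gcongr)
    _ ≤ ∑ j ∈ Finset.range (N + 1), e j (N - j) := by
        refine Finset.sum_le_sum_of_subset_of_nonneg (fun j hj => ?_) fun _ _ _ => he _ _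
        have := (Finset.mem_Ico.1 hj).2
        exact Finset.mem_range.2 (by omega)

theorem isTheta_of_bounds {Q : ℕ → ℝ} {t c C : ℝ} (hc : 0 < c) (hQ : ∀ n, 0 ≤ Q n)
    (hlow : ∀ N : ℕ, 4 ≤ N → c * ((N : ℝ) + 2) ^ t ≤ Q (N + 2))
    (hup : ∀ N : ℕ, Q (N + 2) ≤ C * ((N : ℝ) + 2) ^ t) :
    Q =Θ[atTop] fun n : ℕ => (n : ℝ) ^ t := by
  have hnorm : ∀ n : ℕ, ‖(n : ℝ) ^ t‖ = (n : ℝ) ^ t := fun n =>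
    Real.norm_of_nonneg (by positivity)
  refine ⟨IsBigO.of_bound C ?_, IsBigO.of_bound c⁻¹ ?_⟩
  · filter_upwards [eventually_ge_atTop 6] with n hn
    obtain ⟨N, rfl⟩ : ∃ N, n = N + 2 := ⟨n - 2, by omega⟩
    rw [hnorm, Real.norm_of_nonneg (hQ _)]
    exact_mod_cast hup N
  · filter_upwards [eventually_ge_atTop 6] with n hn
    obtain ⟨N, rfl⟩ : ∃ N, n = N + 2 := ⟨n - 2, by omega⟩
    rw [hnorm, Real.norm_of_nonneg (hQ _), ← div_eq_inv_mul, le_div_iff₀' hc]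
    exact_mod_cast hlow N (by omega)

end SumAsymptotics

end PolyaUrn

/-! ### The main theorem -/

theorem mainTheorem8 {Ω : Type*} [MeasurableSpace Ω] (μ : Measure Ω) [IsProbabilityMeasure μ]
    (α b : Fin 2 → ℝ) (hα : ∀ i, 0 < α i) (hb : ∀ i, 1 < b i)
    (x₀ : Fin 2 → ℕ) (hx₀ : ∀ i, 1 ≤ x₀ i)
    (X : ℕ → Ω → Fin 2 → ℕ)
    (hX : PolyaUrn.IsUrn μ (fun i => PolyaUrn.powerFeedback (α i) (b i)) x₀ X)
    (c : ℝ) (hc : PolyaUrn.AdmissibleConst α b x₀ c)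
    (hunif : PolyaUrn.UniformityCondition μ b x₀ X c) :
    (b 0 ≤ b 1 + 1 →
      (fun n : ℕ => (μ[|PolyaUrn.sMon X 0]).real {ω | PolyaUrn.monopolyTime X ω = (n : ℕ∞)})
        =Θ[atTop] fun n : ℕ => (n : ℝ) ^ ((b 0 - 1) / b 1 - b 0)) ∧
    (b 1 + 1 ≤ b 0 →
      (fun n : ℕ => (μ[|PolyaUrn.sMon X 0]).real {ω | PolyaUrn.monopolyTime X ω = (n : ℕ∞)})
        =Θ[atTop] fun n : ℕ => (n : ℝ) ^ (-b 1)) := by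
  have hF : ∀ i k, 1 ≤ k → 0 < PolyaUrn.powerFeedback (α i) (b i) k :=
    fun i k hk => PolyaUrn.powerFeedback_pos (hα i) hk
  obtain ⟨m, M, hm, hM, hlow⟩ := hX.exists_le_measureReal_escapeForever hα hb hx₀
  have hup := hX.exists_measureReal_escapeForever_le hα hb hx₀
  have hnn : ∀ j k, 0 ≤ μ.real (PolyaUrn.escapeForever x₀ X j k) := fun _ _ => measureReal_nonneg
  -- A single escape event already has positive probability, so conditioning only rescales by a
  -- positive constant.
  have hpos : 0 < μ.real (PolyaUrn.sMon X 0) :=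
    lt_of_lt_of_le (by positivity) ((hlow 0 0).trans
      (measureReal_mono (PolyaUrn.escapeForever_subset_sMon 0 0)))
  have hcond : (fun n : ℕ => (μ[|PolyaUrn.sMon X 0]).real
      {ω | PolyaUrn.monopolyTime X ω = (n : ℕ∞)}) = fun n : ℕ => (μ.real (PolyaUrn.sMon X 0))⁻¹ *
      μ.real (PolyaUrn.sMon X 0 ∩ {ω | PolyaUrn.monopolyTime X ω = (n : ℕ∞)}) :=
    funext fun n => by
      simp only [Measure.real]
      rw [cond_apply (hX.measurableSet_sMon 0), ENNReal.toReal_mul, ENNReal.toReal_inv]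
  have hθ : ∀ t : ℝ, (fun n : ℕ => μ.real (PolyaUrn.sMon X 0 ∩
      {ω | PolyaUrn.monopolyTime X ω = (n : ℕ∞)})) =Θ[atTop] (fun n : ℕ => (n : ℝ) ^ t) →
      (fun n : ℕ => (μ[|PolyaUrn.sMon X 0]).real {ω | PolyaUrn.monopolyTime X ω = (n : ℕ∞)})
        =Θ[atTop] fun n : ℕ => (n : ℝ) ^ t := by
    intro t h
    rw [hcond]
    exact h.const_mul_left (inv_ne_zero hpos.ne')
  have hsum := hX.measureReal_sMon_inter hF hx₀
  refine ⟨fun h => hθ _ ?_, fun h => hθ _ ?_⟩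
  · obtain ⟨c₁, hc₁, h₁⟩ := PolyaUrn.exists_le_sum_of_le hm hM (hb 0) (hb 1) h hnn hlow
    obtain ⟨c₂, -, h₂⟩ := PolyaUrn.exists_sum_le_of_le (hb 0) (hb 1) h hup
    exact PolyaUrn.isTheta_of_bounds hc₁ (fun n => measureReal_nonneg)
      (fun N _ => (h₁ N).trans_eq (hsum N).symm) fun N => (hsum N).trans_le (h₂ N)
  · obtain ⟨c₁, hc₁, h₁⟩ := PolyaUrn.exists_le_sum_of_ge hm hM (hb 0) (hb 1) h hnn hlow
    obtain ⟨c₂, -, h₂⟩ := PolyaUrn.exists_sum_le_of_ge (hb 0) (hb 1) h hup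
    exact PolyaUrn.isTheta_of_bounds hc₁ (fun n => measureReal_nonneg)
      (fun N hN => (h₁ N hN).trans_eq (hsum N).symm) fun N => (hsum N).trans_le (h₂ N)
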